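/- Let $\mathcal E$ be a symmetric monoidal category with finite colimits which is additive over a field of characteristic zero (i.e. linear over that field, with bilinear tensor product). An $\mathbb S$-module $\mathcal W$ in $\mathcal E$ is a sequence of representations $\mathcal W(n)$ of the symmetric groups $\mathbb S_n$ in $\mathcal E$, $n\ge 1$; its value on a nonempty finite set $S$ is defined by numbering $S$. The plethysm of $\mathbb S$-modules is $$(\mathcal V\circ\mathcal W)(n)=\bigoplus_{k\ge 1}\mathcal V(k)\otimes_{\mathbb S_k}\mathcal W^{\otimes k}(n),$$ where $\mathcal W^{\otimes k}(n)=\bigoplus_{f:\{1,\dots,n\}\twoheadrightarrow\{1,\dots,k\}}\mathcal W(f^{-1}(1))\otimes\cdots\otimes\mathcal W(f^{-1}(k))$ is the $k$-fold tensor power for $(\mathcal V\otimes \mathcal W)(n)=\bigoplus_{k+l=n}\mathrm{Ind}_{\mathbb S_k\times\mathbb S_l}^{\mathbb S_n}\mathcal V(k)\otimes \mathcal W(l)$, and $\mathbb S_k$ permutes the factors. Let $\mathsf{Ass}(n)=\mathrm{Ind}_{\mathbb Z/n\mathbb Z}^{\mathbb S_n}\mathbf 1$, where $\mathbf 1$ is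 the trivial representation on the monoidal unit. Let $\mathcal V$ be a stable $\mathbb S$-module in $\mathcal E$: representations $\mathcal V((g,n))$ of $\mathbb S_n$ for $g,n\ge 0$, zero unless $2g-2+n>0$. Let $\mathbf a_0''$ be the $\mathbb S$-module with $\mathbf a_0''(n)=\mathrm{Res}^{\mathbb S_{n+2}}_{\mathbb S_n}\mathcal V((0,n+2))$. A graph is a finite set of flags with a partition (the blocks are the vertices) and an involution (the fixed points are the legs, the two-element orbits are the edges). A necklace is a connected graph with first Betti number $1$ that is not disconnected by removing any edge. A cyclically ordered necklace of genus zero vertices is a necklace, all of whose vertices have genus zero and (stability) at least three flags, with a choice of direction around it, i.e. a direction of every edge such that each vertex is the source of exactly one edge and the target of exactly one edge. The $\mathbb S$-module describing these necklaces has as its $n$-th term the colimit of $$\mathcal V((\Gamma))=\bigotimes_{v\in\mathrm{Vert}(\Gamma)}\mathcal V((0,\mathrm{Leg}(v)))$$ over the groupoid of cyclically ordered necklaces $\Gamma$ of genus zero vertices with legs labelled by $\{1,\dots,n\}$ and their isomorphisms (which preserve the direction and the labels), where $\mathrm{Leg}(v)$ is the set of flags at $v$; the group $\mathbb S_n$ acts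 by relabelling the legs. Then the plethysm $\mathsf{Ass}\circ\mathbf a_0''$ is the $\mathbb S$-module describing cyclically ordered necklaces of genus zero vertices: for every $n\ge1$ there are maps $\mathcal V((\Gamma))\to(\mathsf{Ass}\circ\mathbf a_0'')(n)$ that make $(\mathsf{Ass}\circ\mathbf a_0'')(n)$ the above colimit (which in particular exists), and the action of $\mathbb S_n$ corresponds to the relabelling of the legs. -/

import Mathlib

open CategoryTheory MonoidalCategory Limits

noncomputable section

namespace SModules

universe v u

theorem comp_cons {E : Type u} [Category.{v} E] [MonoidalCategory E] {A B C L M N M' N' : E} (f : A ⟶ B) (g : B ⟶ C) (p : L ⟶ M) (i : B ⊗ M ⟶ M')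
    (q : M' ⟶ N') (q' : M ⟶ N) (k : C ⊗ N ⟶ N') (h : i ≫ q = (g ⊗ₘ q') ≫ k) :
    ((f ⊗ₘ p) ≫ i) ≫ q = ((f ≫ g) ⊗ₘ (p ≫ q')) ≫ k := by
  rw [Category.assoc, h, ← tensorHom_comp_tensorHom, Category.assoc]

section UnorderedTensor

variable {E : Type u} [Category.{v} E] [MonoidalCategory E] [SymmetricCategory E]

/-- The tensor product `X a₁ ⊗ (X a₂ ⊗ (⋯ ⊗ 𝟙))` along a list of indices. -/
def listTensor {I : Type} (X : I → E) : List I → E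
  | [] => 𝟙_ E
  | a :: l => X a ⊗ listTensor X l

/-- `Insertion a l m`: the list `m` is obtained by inserting `a` somewhere into `l`. -/
inductive Insertion {I : Type} (a : I) : List I → List I → Type
  | here (l : List I) : Insertion a l (a :: l)
  | there (b : I) {l m : List I} (i : Insertion a l m) : Insertion a (b :: l) (b :: m)

/-- `Matching e l m`: a bijection of the positions of `l` with those of `m` which is given by `e`
on the entries. -/
inductive Matching {I J : Type} (e : I → J) : List I → List J → Type
  | nil : Matching e [] []
  | cons {a : I} {l : List I} {m m' : List J} (p : Matching e l m)
      (i : Insertion (e a) m m') : Matching e (a :: l) m'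

/-- The symmetry `A ⊗ (B ⊗ C) ⟶ B ⊗ (A ⊗ C)`. -/
def swapHom (A B C : E) : A ⊗ (B ⊗ C) ⟶ B ⊗ (A ⊗ C) :=
  (α_ A B C).inv ≫ (β_ A B).hom ▷ C ≫ (α_ B A C).hom

/-- Moving the first tensor factor into the place of an insertion. -/
def Insertion.hom {I : Type} (X : I → E) {a : I} :
    {l m : List I} → Insertion a l m → (X a ⊗ listTensor X l ⟶ listTensor X m)
  | _, _, .here _ => 𝟙 _
  | _, _, .there b i => swapHom _ _ _ ≫ X b ◁ i.hom X

/-- The map of tensor products given by maps `X a ⟶ Y (e a)` of the factors followed by the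
permutation of the factors. -/
def Matching.hom {I J : Type} {e : I → J} {X : I → E} {Y : J → E} (f : ∀ a, X a ⟶ Y (e a)) :
    {l : List I} → {m : List J} → Matching e l m → (listTensor X l ⟶ listTensor Y m)
  | _, _, .nil => 𝟙 _
  | a :: _, _, .cons p i => (f a ⊗ₘ p.hom f) ≫ i.hom Y

theorem swapHom_swapHom (A B C : E) : swapHom A B C ≫ swapHom B A C = 𝟙 _ := by
  simp [swapHom, ← comp_whiskerRight_assoc]

theorem swapHom_naturality {A A' B B' C C' : E} (f : A ⟶ A') (g : B ⟶ B') (h : C ⟶ C') :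
    (f ⊗ₘ (g ⊗ₘ h)) ≫ swapHom A' B' C' = swapHom A B C ≫ (g ⊗ₘ (f ⊗ₘ h)) := by
  have h₁ : ((f ⊗ₘ g) ⊗ₘ h) ≫ (β_ A' B').hom ▷ C' = (β_ A B).hom ▷ C ≫ ((g ⊗ₘ f) ⊗ₘ h) := by
    rw [← tensorHom_id, ← tensorHom_id, tensorHom_comp_tensorHom, tensorHom_comp_tensorHom,
      BraidedCategory.braiding_naturality]
    simp
  simp only [swapHom, associator_inv_naturality_assoc, Category.assoc, ← associator_naturality]
  rw [reassoc_of% h₁]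

theorem swapHom_naturality_right (A B : E) {C C' : E} (h : C ⟶ C') :
    A ◁ B ◁ h ≫ swapHom A B C' = swapHom A B C ≫ B ◁ A ◁ h := by
  simpa using swapHom_naturality (𝟙 A) (𝟙 B) h

theorem swapHom_yang_baxter (A B C D : E) :
    A ◁ swapHom B C D ≫ swapHom A C (B ⊗ D) ≫ C ◁ swapHom A B D =
      swapHom A B (C ⊗ D) ≫ B ◁ swapHom A C D ≫ swapHom B C (A ⊗ D) := by
  have h := congrArg (fun t => (α_ A B (C ⊗ D)).inv ≫ (α_ (A ⊗ B) C D).inv ≫ (α_ A B C).hom ▷ D ≫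
    t ▷ D ≫ (α_ C (B ⊗ A) D).hom ≫ C ◁ (α_ B A D).hom) (BraidedCategory.yang_baxter A B C)
  simp only [swapHom]
  convert h.symm using 1
  · monoidal
  · monoidal

theorem comm_here {A B T M : E} (i : A ⊗ T ⟶ M) :
    B ◁ i ≫ 𝟙 _ = swapHom B A T ≫ A ◁ 𝟙 _ ≫ swapHom A B T ≫ B ◁ i := by
  simp [reassoc_of% swapHom_swapHom]

theorem comm_there {A B C L M L' N : E} (i : A ⊗ L ⟶ M) (j : B ⊗ M ⟶ N) (j' : B ⊗ L ⟶ L')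
    (i' : A ⊗ L' ⟶ N) (h : B ◁ i ≫ j = swapHom B A L ≫ A ◁ j' ≫ i') :
    B ◁ (swapHom A C L ≫ C ◁ i) ≫ swapHom B C M ≫ C ◁ j =
      swapHom B A (C ⊗ L) ≫ A ◁ (swapHom B C L ≫ C ◁ j') ≫ swapHom A C L' ≫ C ◁ i' := by
  simp only [MonoidalCategory.whiskerLeft_comp, Category.assoc]
  rw [reassoc_of% (swapHom_naturality_right B C i), reassoc_of% (swapHom_naturality_right A C j'),
    ← MonoidalCategory.whiskerLeft_comp, h, ← reassoc_of% (swapHom_yang_baxter B A C L)]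
  simp

theorem Insertion.comm {I : Type} (X : I → E) {a b : I} {m n : List I} (j : Insertion b m n) :
    ∀ {l : List I} (i : Insertion a l m), ∃ (l' : List I) (j' : Insertion b l l')
      (i' : Insertion a l' n),
      X b ◁ i.hom X ≫ j.hom X = swapHom _ _ _ ≫ X a ◁ j'.hom X ≫ i'.hom X := by
  induction j with
  | here m =>
    intro l i
    exact ⟨_, .here l, .there b i, comm_here _⟩
  | there c j ih =>
    intro l i
    cases i with
    | here =>
      refine ⟨_, j, .here _, ?_⟩
      exact (congrArg (· ≫ _) (whiskerLeft_id _ _)).trans ((Category.id_comp _).trans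
        (congrArg (swapHom _ _ _ ≫ ·) (Category.comp_id _).symm))
    | there _ i =>
      obtain ⟨l', j', i', h⟩ := ih i
      exact ⟨_, .there c j', .there c i', comm_there _ _ _ _ h⟩

theorem comp_insertion_there {A B L M N N' N'' A' B' P : E} (f : A ⟶ A') (g : B ⟶ B')
    (i : A ⊗ L ⟶ M) (p : M ⟶ N) (k : B' ⊗ N ⟶ P) (q : L ⟶ N') (k' : A' ⊗ N' ⟶ N)
    (j' : B' ⊗ N' ⟶ N'') (i' : A' ⊗ N'' ⟶ P)
    (h : i ≫ p = (f ⊗ₘ q) ≫ k') (h' : B' ◁ k' ≫ k = swapHom _ _ _ ≫ A' ◁ j' ≫ i') :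
    (swapHom A B L ≫ B ◁ i) ≫ (g ⊗ₘ p) ≫ k = (f ⊗ₘ ((g ⊗ₘ q) ≫ j')) ≫ i' := by
  have h₁ : B ◁ i ≫ (g ⊗ₘ p) = (g ⊗ₘ (f ⊗ₘ q)) ≫ B' ◁ k' := by
    rw [← id_tensorHom, ← id_tensorHom, tensorHom_comp_tensorHom, tensorHom_comp_tensorHom, h]
    simp
  have h₂ : (f ⊗ₘ ((g ⊗ₘ q) ≫ j')) = (f ⊗ₘ (g ⊗ₘ q)) ≫ A' ◁ j' := by
    rw [← id_tensorHom, tensorHom_comp_tensorHom]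
    simp
  rw [Category.assoc, reassoc_of% h₁, h', reassoc_of% (swapHom_naturality g f q),
    reassoc_of% (swapHom_swapHom A B L), h₂, Category.assoc]

theorem Matching.exists_comp_insertion {I J : Type} {e : I → J} {X : I → E} {Y : J → E}
    (f : ∀ a, X a ⟶ Y (e a)) {a : I} {l m : List I} (i : Insertion a l m) :
    ∀ {n : List J} (q : Matching e m n), ∃ (n' : List J) (q' : Matching e l n')
      (k : Insertion (e a) n' n),
      i.hom X ≫ q.hom f = (f a ⊗ₘ q'.hom f) ≫ k.hom Y := by
  induction i with
  | here l =>
    intro n q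
    cases q with
    | cons p k => exact ⟨_, p, k, Category.id_comp _⟩
  | there b i ih =>
    intro n q
    cases q with
    | cons p k =>
      obtain ⟨n', q', k', h⟩ := ih p
      obtain ⟨n'', j', i', h'⟩ := k.comm Y k'
      exact ⟨_, q'.cons j', i', comp_insertion_there _ _ _ _ _ _ _ _ _ h h'⟩

theorem Matching.exists_comp {I J K : Type} {e : I → J} {e' : J → K} {X : I → E} {Y : J → E}
    {Z : K → E} (f : ∀ a, X a ⟶ Y (e a)) (g : ∀ a, Y a ⟶ Z (e' a)) {l : List I} {m : List J}
    (p : Matching e l m) : ∀ {n : List K} (q : Matching e' m n),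
      ∃ r : Matching (fun a => e' (e a)) l n,
        p.hom f ≫ q.hom g = r.hom (fun a => f a ≫ g (e a)) := by
  induction p with
  | nil =>
    intro n q
    cases q
    exact ⟨.nil, Category.id_comp _⟩
  | cons p i ih =>
    intro n q
    obtain ⟨n', q', k, h⟩ := Matching.exists_comp_insertion g i q
    obtain ⟨r, hr⟩ := ih q'
    refine ⟨r.cons k, (comp_cons _ _ _ _ _ _ _ h).trans ?_⟩
    rw [hr]
    rfl

theorem Matching.exists_id {I : Type} (X : I → E) (l : List I) :
    ∃ p : Matching (fun a : I => a) l l, p.hom (fun a => 𝟙 (X a)) = 𝟙 _ := by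
  induction l with
  | nil => exact ⟨.nil, rfl⟩
  | cons a l ih =>
    obtain ⟨p, hp⟩ := ih
    refine ⟨p.cons (.here l), ?_⟩
    have h : (𝟙 (X a) ⊗ₘ p.hom (fun a => 𝟙 (X a))) ≫ 𝟙 _ = 𝟙 _ := by rw [hp]; simp
    exact h

theorem Insertion.mem {I : Type} {a : I} {l m : List I} (i : Insertion a l m) : a ∈ m := by
  induction i with
  | here => simp
  | there b i ih => simp [ih]

theorem Insertion.sublist {I : Type} {a : I} {l m : List I} (i : Insertion a l m) :
    l.Sublist m := by
  induction i with
  | here => simp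
  | there b i ih => exact ih.cons_cons b

theorem Insertion.unique {I : Type} {a : I} {l m : List I} (i : Insertion a l m) (hm : m.Nodup) :
    ∀ {l' : List I} (i' : Insertion a l' m), ∃ h : l = l', h ▸ i = i' := by
  induction i with
  | here l =>
    intro l' i'
    cases i' with
    | here => exact ⟨rfl, rfl⟩
    | there _ i' => exact absurd i'.mem (List.nodup_cons.1 hm).1
  | there b i ih =>
    intro l' i'
    cases i' with
    | here => exact absurd i.mem (List.nodup_cons.1 hm).1
    | there _ i' =>
      obtain ⟨rfl, rfl⟩ := ih (List.nodup_cons.1 hm).2 i'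
      exact ⟨rfl, rfl⟩

theorem Matching.unique {I J : Type} {e : I → J} {l : List I} {m : List J}
    (p : Matching e l m) (hm : m.Nodup) : ∀ q : Matching e l m, p = q := by
  induction p with
  | nil => intro q; cases q; rfl
  | cons p i ih =>
    intro q
    cases q with
    | cons q j =>
      obtain ⟨rfl, rfl⟩ := i.unique hm j
      rw [ih (hm.sublist i.sublist) q]

theorem Insertion.exists_of_append {I : Type} (a : I) (s t : List I) :
    Nonempty (Insertion a (s ++ t) (s ++ a :: t)) := by
  induction s with
  | nil => exact ⟨.here t⟩
  | cons b s ih => exact ⟨.there b ih.some⟩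

theorem Matching.exists_of_perm {I J : Type} (e : I → J) (l : List I) :
    ∀ m : List J, (l.map e).Perm m → Nonempty (Matching e l m) := by
  induction l with
  | nil => intro m h; rw [List.map_nil, List.nil_perm] at h; subst h; exact ⟨.nil⟩
  | cons a l ih =>
    intro m h
    obtain ⟨s, t, rfl⟩ := List.append_of_mem (h.subset (List.mem_cons_self))
    obtain ⟨p⟩ := ih (s ++ t) (List.Perm.cons_inv (h.trans List.perm_middle))
    exact ⟨p.cons (Insertion.exists_of_append (e a) s t).some⟩

/-- An enumeration of a finite type. -/
def enum (I : Type) [Finite I] : List I :=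
  (List.finRange (Nat.card I)).map (Finite.equivFin I).symm

theorem nodup_enum (I : Type) [Finite I] : (enum I).Nodup :=
  (List.nodup_finRange _).map (Finite.equivFin I).symm.injective

theorem mem_enum {I : Type} [Finite I] (a : I) : a ∈ enum I :=
  List.mem_map.2 ⟨Finite.equivFin I a, List.mem_finRange _, by simp⟩

theorem enum_perm {I J : Type} [Finite I] [Finite J] (e : I ≃ J) :
    ((enum I).map e).Perm (enum J) :=
  (List.perm_ext_iff_of_nodup ((nodup_enum I).map e.injective) (nodup_enum J)).2 fun b =>
    ⟨fun _ => mem_enum b, fun _ => List.mem_map.2 ⟨e.symm b, mem_enum _, by simp⟩⟩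

/-- The tensor product `⨂ i, X i` of a finite family of objects of a symmetric monoidal category,
formed along an enumeration of the index set. By `tensorMap`, different enumerations are identified
through the symmetry. -/
def bigTensor {I : Type} [Finite I] (X : I → E) : E := listTensor X (enum I)

/-- The map `⨂ i, X i ⟶ ⨂ j, Y j` induced by a bijection `e` of the index sets and maps
`X i ⟶ Y (e i)` of the factors; the factors are permuted through the symmetry of `E`. -/
def tensorMap {I J : Type} [Finite I] [Finite J] {X : I → E} {Y : J → E} (e : I ≃ J)
    (f : ∀ i, X i ⟶ Y (e i)) : bigTensor X ⟶ bigTensor Y :=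
  (Matching.exists_of_perm e (enum I) (enum J) (enum_perm e)).some.hom f

theorem tensorMap_id {I : Type} [Finite I] (X : I → E) :
    tensorMap (Equiv.refl I) (fun i => 𝟙 (X i)) = 𝟙 (bigTensor X) := by
  obtain ⟨p, hp⟩ := Matching.exists_id X (enum I)
  exact (congrArg (Matching.hom (fun i => 𝟙 (X i)))
    (Matching.unique (Matching.exists_of_perm (Equiv.refl I) (enum I) (enum I) (enum_perm _)).some
      (nodup_enum I) p)).trans hp

theorem tensorMap_comp {I J K : Type} [Finite I] [Finite J] [Finite K] {X : I → E} {Y : J → E}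
    {Z : K → E} (e : I ≃ J) (f : ∀ i, X i ⟶ Y (e i)) (e' : J ≃ K) (g : ∀ j, Y j ⟶ Z (e' j)) :
    tensorMap e f ≫ tensorMap e' g =
      tensorMap (Y := Z) (e.trans e') (fun i => f i ≫ g (e i)) := by
  obtain ⟨r, hr⟩ := Matching.exists_comp f g
    (Matching.exists_of_perm e (enum I) (enum J) (enum_perm e)).some
    (Matching.exists_of_perm e' (enum J) (enum K) (enum_perm e')).some
  exact hr.trans (congrArg (Matching.hom (e := e.trans e') fun i => f i ≫ g (e i))
    (Matching.unique r (nodup_enum K) _))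

end UnorderedTensor

section SModule

variable (E : Type u) [Category.{v} E]

/-- An `𝕊`-module in `E`: a representation of `𝕊ₙ` in `E` for each positive integer `n`.
The category structure is the one of a product of categories of representations. -/
abbrev SModule : Type max u v := ∀ n : ℕ+, Action E (Equiv.Perm (Fin n))

/-- A stable `𝕊`-module in `E`: representations `V((g, n))` of `𝕊ₙ` in `E` for `g, n ≥ 0`, which
are zero unless `2 g - 2 + n > 0`. -/
structure StableSModule : Type max u v where
  rep : ∀ _g n : ℕ, Action E (Equiv.Perm (Fin n))
  isZero : ∀ g n : ℕ, 2 * g + n ≤ 2 → IsZero (rep g n).V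

variable {E}

/-- Representations of symmetric groups `𝕊_{d i}` are extended to finite sets with `d i` elements by
numbering these sets. A bijection `e : S ≃ T` then acts by the permutation that it induces between
the numberings. -/
def extMap {ι : Type} {d : ι → ℕ} (R : ∀ i, Action E (Equiv.Perm (Fin (d i)))) {S T : Type}
    {i j : ι} (h : i = j) (eS : S ≃ Fin (d i)) (eT : T ≃ Fin (d j)) (e : S ≃ T) :
    (R i).V ⟶ (R j).V :=
  eqToHom (by rw [h]) ≫
    (R j).ρ ((finCongr (congrArg d h)).symm.trans (eS.symm.trans (e.trans eT)))

theorem extMap_refl {ι : Type} {d : ι → ℕ} (R : ∀ i, Action E (Equiv.Perm (Fin (d i)))) {S : Type}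
    {i : ι} (h : i = i) (eS : S ≃ Fin (d i)) : extMap R h eS eS (Equiv.refl S) = 𝟙 _ := by
  have : (finCongr (congrArg d h)).symm.trans (eS.symm.trans ((Equiv.refl S).trans eS)) = 1 := by
    ext x; simp
  rw [extMap, this, map_one]
  exact Category.id_comp _

theorem extMap_comp {ι : Type} {d : ι → ℕ} (R : ∀ i, Action E (Equiv.Perm (Fin (d i))))
    {S T U : Type} {i j k : ι} (h : i = j) (h' : j = k) (h'' : i = k) (eS : S ≃ Fin (d i))
    (eT : T ≃ Fin (d j)) (eU : U ≃ Fin (d k)) (e : S ≃ T) (e' : T ≃ U) :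
    extMap R h eS eT e ≫ extMap R h' eT eU e' = extMap R h'' eS eU (e.trans e') := by
  subst h h'
  have : (finCongr (congrArg d h'')).symm.trans (eS.symm.trans ((e.trans e').trans eU)) =
      ((finCongr rfl).symm.trans (eT.symm.trans (e'.trans eU)) *
        (finCongr rfl).symm.trans (eS.symm.trans (e.trans eT)) : Equiv.Perm (Fin (d i))) := by
    ext x; simp
  simp only [extMap, this, map_mul, eqToHom_refl]
  exact (congrArg₂ (· ≫ ·) (Category.id_comp _) (Category.id_comp _)).trans
    (Category.id_comp _).symm

/-- The value `W(S)` of an `𝕊`-module on a nonempty finite set. -/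
def SModule.obj (W : SModule E) (S : Type) [Finite S] [Nonempty S] : E :=
  (W ⟨Nat.card S, Nat.card_pos⟩).V

/-- The map `W(S) ⟶ W(T)` induced by a bijection. -/
def SModule.map (W : SModule E) {S T : Type} [Finite S] [Nonempty S] [Finite T] [Nonempty T]
    (e : S ≃ T) : SModule.obj W S ⟶ SModule.obj W T :=
  extMap (d := fun n : ℕ+ => (n : ℕ)) W (PNat.eq (Nat.card_congr e))
    (Finite.equivFin S) (Finite.equivFin T) e

theorem SModule.map_refl (W : SModule E) (S : Type) [Finite S] [Nonempty S] :
    SModule.map W (Equiv.refl S) = 𝟙 _ :=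
  extMap_refl _ _ _

theorem SModule.map_trans (W : SModule E) {S T U : Type} [Finite S] [Nonempty S] [Finite T]
    [Nonempty T] [Finite U] [Nonempty U] (e : S ≃ T) (e' : T ≃ U) :
    SModule.map W e ≫ SModule.map W e' = SModule.map W (e.trans e') :=
  extMap_comp _ _ _ _ _ _ _ _ _

/-- The value `V((g, S))` of a stable `𝕊`-module on a finite set. -/
def StableSModule.obj (V : StableSModule E) (g : ℕ) (S : Type) [Finite S] : E :=
  (V.rep g (Nat.card S)).V

/-- The map `V((g, S)) ⟶ V((g, T))` induced by a bijection. -/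
def StableSModule.map (V : StableSModule E) (g : ℕ) {S T : Type} [Finite S] [Finite T]
    (e : S ≃ T) : V.obj g S ⟶ V.obj g T :=
  extMap (d := fun n : ℕ => n) (V.rep g) (Nat.card_congr e)
    (Finite.equivFin S) (Finite.equivFin T) e

theorem StableSModule.map_refl (V : StableSModule E) (g : ℕ) (S : Type) [Finite S] :
    V.map g (Equiv.refl S) = 𝟙 _ :=
  extMap_refl _ _ _

theorem StableSModule.map_trans (V : StableSModule E) (g : ℕ) {S T U : Type} [Finite S] [Finite T]
    [Finite U] (e : S ≃ T) (e' : T ≃ U) : V.map g e ≫ V.map g e' = V.map g (e.trans e') :=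
  extMap_comp _ _ _ _ _ _ _ _ _

/-- The `𝕊`-module `𝐚₀''` of a stable `𝕊`-module `V`: its `n`-th term is the restriction of
`V((0, n + 2))` to `𝕊ₙ`, which permutes the first `n` legs and fixes the last two (marked) legs. -/
def aZeroSecond (V : StableSModule E) : SModule E := fun n =>
  (Action.res E (Equiv.Perm.viaEmbeddingHom (Fin.castAddEmb (n := (n : ℕ)) 2))).obj
    (V.rep 0 ((n : ℕ) + 2))

end SModule

section Plethysm

variable {E : Type u} [Category.{v} E] [HasFiniteColimits E]

instance hasColimitsOfShape_singleObj (G : Type) [Group G] [Finite G] :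
    HasColimitsOfShape (SingleObj G) E := by
  have := Fintype.ofFinite G
  infer_instance

/-- The direct sum of finitely many representations. -/
def directSum {G : Type} [Group G] {ι : Type} [Finite ι] (X : ι → Action E G) : Action E G where
  V := ∐ fun i => (X i).V
  ρ :=
    { toFun g := Limits.Sigma.map fun i => (X i).ρ g
      map_one' := by
        refine Limits.Sigma.hom_ext _ _ fun i => ?_
        rw [Limits.Sigma.ι_map, map_one]
        exact (Category.id_comp _).trans (Category.comp_id _).symm
      map_mul' g h := by
        refine Limits.Sigma.hom_ext _ _ fun i => ?_
        rw [Limits.Sigma.ι_map, map_mul, End.mul_def, End.mul_def, Limits.Sigma.ι_map_assoc,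
          Limits.Sigma.ι_map, Category.assoc] }

/-- The action of `G` underlying an action of `G × H`, as a diagram. -/
def leftDiagram {G H : Type} [Group G] [Group H] (X : Action E (G × H)) : SingleObj G ⥤ E where
  obj _ := X.V
  map g := X.ρ ((g : G), 1)
  map_id _ := X.ρ.map_one
  map_comp g h := by
    have : ((h * g : G), (1 : H)) = ((h : G), 1) * ((g : G), 1) :=
      Prod.ext rfl (mul_one _).symm
    exact (congrArg X.ρ this).trans (X.ρ.map_mul _ _)

/-- The action of an element of `H` on the `G`-coinvariants. -/
def leftDiagramMap {G H : Type} [Group G] [Group H] (X : Action E (G × H)) (h : H) :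
    leftDiagram X ⟶ leftDiagram X where
  app _ := X.ρ (1, h)
  naturality _ _ g := by
    have : ((1 : G), h) * ((g : G), 1) = ((g : G), 1) * (1, h) :=
      Prod.ext ((one_mul _).trans (mul_one _).symm) ((mul_one _).trans (one_mul _).symm)
    exact (X.ρ.map_mul _ _).symm.trans ((congrArg X.ρ this).trans (X.ρ.map_mul _ _))

/-- The coinvariants of `G` on a representation of `G × H`, as a representation of `H`. -/
def coinvariants {G H : Type} [Group G] [Finite G] [Group H] (X : Action E (G × H)) :
    Action E H where
  V := colimit (leftDiagram X)
  ρ :=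
    { toFun h := colimMap (leftDiagramMap X h)
      map_one' := by
        refine colimit.hom_ext fun j => ?_
        rw [ι_colimMap]
        exact (congrArg (· ≫ _) X.ρ.map_one).trans
          ((Category.id_comp _).trans (Category.comp_id _).symm)
      map_mul' h h' := by
        refine colimit.hom_ext fun j => ?_
        have : ((1 : G), h * h') = (1, h) * (1, h') := by simp
        rw [End.mul_def, ι_colimMap, ι_colimMap_assoc, ι_colimMap, ← Category.assoc]
        exact congrArg (· ≫ _) ((congrArg X.ρ this).trans (X.ρ.map_mul _ _)) }

/-- The surjections `{1, …, n} → {1, …, k}`. -/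
abbrev Surj (n k : ℕ) : Type := {f : Fin n → Fin k // Function.Surjective f}

/-- The fibre `f⁻¹(i)`. -/
def Surj.Fiber {n k : ℕ} (f : Surj n k) (i : Fin k) : Type := {s : Fin n // f.1 s = i}

instance {n k : ℕ} (f : Surj n k) (i : Fin k) : Finite (f.Fiber i) :=
  inferInstanceAs (Finite {s : Fin n // f.1 s = i})

instance {n k : ℕ} (f : Surj n k) (i : Fin k) : Nonempty (f.Fiber i) :=
  let ⟨s, hs⟩ := f.2 i
  ⟨⟨s, hs⟩⟩

/-- The action of `𝕊ₖ × 𝕊ₙ` on surjections by `f ↦ σ ∘ f ∘ τ⁻¹`. -/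
def Surj.act {n k : ℕ} (g : Equiv.Perm (Fin k) × Equiv.Perm (Fin n)) (f : Surj n k) : Surj n k :=
  ⟨g.1 ∘ f.1 ∘ g.2.symm, g.1.surjective.comp (f.2.comp g.2.symm.surjective)⟩

/-- The bijection `f⁻¹(i) ≃ f'⁻¹(σ i)` given by `τ`, if `f' ∘ τ = σ ∘ f`. -/
def Surj.fiberEquiv {n k : ℕ} {f f' : Surj n k} (σ : Equiv.Perm (Fin k)) (τ : Equiv.Perm (Fin n))
    (h : ∀ s, f'.1 (τ s) = σ (f.1 s)) (i : Fin k) : f.Fiber i ≃ f'.Fiber (σ i) :=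
  τ.subtypeEquiv fun s => by rw [h, σ.apply_eq_iff_eq]

end Plethysm

section TensorPower

variable {E : Type u} [Category.{v} E] [MonoidalCategory E] [SymmetricCategory E]

/-- The summand `⨂ i, W(f⁻¹(i))` of `W^{⊗ k}(n)`. -/
def powSummand (W : SModule E) {n k : ℕ} (f : Surj n k) : E :=
  bigTensor fun i => SModule.obj W (f.Fiber i)

/-- The map between summands of `W^{⊗ k}(n)` given by permutations of the factors and of the
labels. -/
def powSummandMap (W : SModule E) {n k : ℕ} {f f' : Surj n k} (σ : Equiv.Perm (Fin k))
    (τ : Equiv.Perm (Fin n)) (h : ∀ s, f'.1 (τ s) = σ (f.1 s)) :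
    powSummand W f ⟶ powSummand W f' :=
  tensorMap σ fun i => SModule.map W (Surj.fiberEquiv σ τ h i)

theorem powSummandMap_one (W : SModule E) {n k : ℕ} {f : Surj n k}
    (h : ∀ s, f.1 ((1 : Equiv.Perm (Fin n)) s) = (1 : Equiv.Perm (Fin k)) (f.1 s)) :
    powSummandMap W 1 1 h = 𝟙 _ := by
  refine Eq.trans ?_ (tensorMap_id fun i => SModule.obj W (f.Fiber i))
  exact congrArg (tensorMap (Equiv.refl _)) (funext fun i => SModule.map_refl W (f.Fiber i))

theorem powSummandMap_comp (W : SModule E) {n k : ℕ} {f f' f'' : Surj n k}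
    {σ σ' : Equiv.Perm (Fin k)} {τ τ' : Equiv.Perm (Fin n)} (h : ∀ s, f'.1 (τ s) = σ (f.1 s))
    (h' : ∀ s, f''.1 (τ' s) = σ' (f'.1 s))
    (h'' : ∀ s, f''.1 ((τ' * τ) s) = (σ' * σ) (f.1 s)) :
    powSummandMap W σ τ h ≫ powSummandMap W σ' τ' h' = powSummandMap W (σ' * σ) (τ' * τ) h'' := by
  refine (tensorMap_comp _ _ _ _).trans ?_
  exact congrArg (tensorMap (σ.trans σ')) (funext fun i => SModule.map_trans W _ _)

variable [HasFiniteColimits E]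

/-- The tensor power `W^{⊗ k}(n)` with the commuting actions of `𝕊ₖ` (permuting the factors) and
of `𝕊ₙ`. Since `(V ⊗ W)(n) = ⨁_{k + l = n} Ind (V(k) ⊗ W(l))` is the sum of `V(A) ⊗ W(B)` over
the decompositions of `{1, …, n}` into nonempty sets `A`, `B`, the `k`-fold tensor power is the sum
of `W(f⁻¹(1)) ⊗ ⋯ ⊗ W(f⁻¹(k))` over the surjections `f : {1, …, n} → {1, …, k}`. -/
def tensorPow (W : SModule E) (k n : ℕ) :
    Action E (Equiv.Perm (Fin k) × Equiv.Perm (Fin n)) where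
  V := ∐ fun f : Surj n k => powSummand W f
  ρ :=
    { toFun g := Limits.Sigma.desc fun f =>
        powSummandMap W (f' := f.act g) g.1 g.2 (fun s => by simp [Surj.act]) ≫
          Limits.Sigma.ι (fun f : Surj n k => powSummand W f) (f.act g)
      map_one' := by
        refine Limits.Sigma.hom_ext _ _ fun f => ?_
        rw [Limits.Sigma.ι_desc]
        exact (congrArg (· ≫ _) (powSummandMap_one W (f := f) fun _ => rfl)).trans
          ((Category.id_comp _).trans (Category.comp_id _).symm)
      map_mul' g g' := by
        refine Limits.Sigma.hom_ext _ _ fun f => ?_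
        rw [End.mul_def, Limits.Sigma.ι_desc, Limits.Sigma.ι_desc_assoc, Category.assoc,
          Limits.Sigma.ι_desc, ← Category.assoc]
        exact congrArg (· ≫ _) (powSummandMap_comp W _ _ _).symm }

/-- The representation `V ⊗ M` of `G × H`, where `G` acts diagonally and `H` acts on `M`. -/
def diagTensor {G H : Type} [Group G] [Group H] (V : Action E G) (M : Action E (G × H)) :
    Action E (G × H) where
  V := V.V ⊗ M.V
  ρ :=
    { toFun g := V.ρ g.1 ⊗ₘ M.ρ g
      map_one' := by
        rw [Prod.fst_one, map_one, map_one]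
        exact id_tensorHom_id _ _
      map_mul' g h := by
        rw [Prod.fst_mul, map_mul, map_mul]
        exact (tensorHom_comp_tensorHom _ _ _ _).symm }

/-- The plethysm `(V ∘ W)(n) = ⨁_{k ≥ 1} V(k) ⊗_{𝕊ₖ} W^{⊗ k}(n)`, where `V(k) ⊗_{𝕊ₖ} M` is the
object of coinvariants of `V(k) ⊗ M` under the diagonal action of `𝕊ₖ`. The summands with `k > n`
are zero, as `W^{⊗ k}(n)` is an empty direct sum for `k > n`, and are left out. -/
def plethysm (V W : SModule E) : SModule E := fun n =>
  directSum fun k : Set.Iic n => coinvariants (diagTensor (V k) (tensorPow W (k : ℕ+) n))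

/-- The representation `Ind_H^G 𝟏` for the trivial representation on the monoidal unit: the sum of
copies of `𝟏` indexed by `G ⧸ H`, which `G` permutes. -/
def indTrivial (E : Type u) [Category.{v} E] [HasFiniteColimits E] [MonoidalCategory E] {G : Type}
    [Group G] [Finite G] (H : Subgroup G) : Action E G where
  V := ∐ fun _ : G ⧸ H => 𝟙_ E
  ρ :=
    { toFun g := Limits.Sigma.desc fun x => Limits.Sigma.ι (fun _ : G ⧸ H => 𝟙_ E) (g • x)
      map_one' := by
        refine Limits.Sigma.hom_ext _ _ fun x => ?_
        rw [Limits.Sigma.ι_desc, one_smul]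
        exact (Category.comp_id _).symm
      map_mul' g h := by
        refine Limits.Sigma.hom_ext _ _ fun x => ?_
        rw [End.mul_def, Limits.Sigma.ι_desc, Limits.Sigma.ι_desc_assoc, Limits.Sigma.ι_desc,
          mul_smul] }

/-- The `𝕊`-module `Ass`, `Ass(n) = Ind_{ℤ/n}^{𝕊ₙ} 𝟏`, where `ℤ/n` is generated by the cycle
`i ↦ i + 1`. -/
def Ass (E : Type u) [Category.{v} E] [HasFiniteColimits E] [MonoidalCategory E] : SModule E :=
  fun n => indTrivial E (Subgroup.zpowers (finRotate n))

end TensorPower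

section Graph

/-- A graph: a finite set of flags with a partition, whose blocks are the vertices, and an
involution. -/
structure FlagGraph : Type 1 where
  Flag : Type
  Vert : Type
  [finite_flag : Finite Flag]
  [finite_vert : Finite Vert]
  /-- the block that contains a flag -/
  vert : Flag → Vert
  inv : Flag → Flag
  inv_inv : Function.Involutive inv

attribute [instance] FlagGraph.finite_flag FlagGraph.finite_vert

namespace FlagGraph

variable (Γ : FlagGraph)

/-- The legs: the flags that are fixed by the involution. -/
abbrev Leg : Type := {f : Γ.Flag // Γ.inv f = f}

/-- The edges: the orbits with two elements of the involution. -/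
abbrev Edge : Type := {e : Set Γ.Flag // ∃ f, Γ.inv f ≠ f ∧ e = {f, Γ.inv f}}

/-- The flags at a vertex. -/
abbrev flagsAt (v : Γ.Vert) : Type := {f : Γ.Flag // Γ.vert f = v}

/-- Two vertices are adjacent if an edge joins them. -/
def Adj (v w : Γ.Vert) : Prop := ∃ f, Γ.inv f ≠ f ∧ Γ.vert f = v ∧ Γ.vert (Γ.inv f) = w

/-- The set of connected components. -/
abbrev Component : Type := Quot Γ.Adj

def Connected : Prop := Nat.card Γ.Component = 1

/-- The first Betti number of the realization, a complex of dimension one, from its Euler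
characteristic; the legs do not contribute. -/
def b₁ : ℤ := Nat.card Γ.Edge - Nat.card Γ.Vert + Nat.card Γ.Component

/-- The graph with the edge `{f, inv f}` removed. -/
def removeEdge (f : Γ.Flag) : FlagGraph where
  Flag := {x : Γ.Flag // x ≠ f ∧ x ≠ Γ.inv f}
  Vert := Γ.Vert
  vert x := Γ.vert x.1
  inv x := ⟨Γ.inv x.1, fun h => x.2.2 ((Γ.inv_inv _).symm.trans (congrArg Γ.inv h)), fun h => x.2.1
    (Γ.inv_inv.injective h)⟩
  inv_inv x := Subtype.ext (Γ.inv_inv x.1)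

/-- A necklace: a connected graph with first Betti number one that is not disconnected by removing
any edge. -/
structure IsNecklace : Prop where
  connected : Γ.Connected
  b₁_eq_one : Γ.b₁ = 1
  connected_removeEdge : ∀ f, Γ.inv f ≠ f → (Γ.removeEdge f).Connected

end FlagGraph

/-- A cyclically ordered necklace of genus zero vertices with legs labelled by `{1, …, n}`. All
vertices have genus zero, and stability says that they have at least three flags. The cyclic
ordering is a direction around the necklace: each edge is directed, such that each vertex is the
source of exactly one edge and the target of exactly one edge. It is recorded by the set of
outgoing flags (the sources of the edges). -/
structure CyclicNecklace (n : ℕ) : Type 1 where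
  graph : FlagGraph
  isNecklace : graph.IsNecklace
  stable : ∀ v, 3 ≤ Nat.card (graph.flagsAt v)
  label : graph.Leg ≃ Fin n
  out : Set graph.Flag
  inv_ne_of_mem_out : ∀ f ∈ out, graph.inv f ≠ f
  inv_mem_out_iff : ∀ f, graph.inv f ≠ f → (graph.inv f ∈ out ↔ f ∉ out)
  existsUnique_out : ∀ v, ∃! f, graph.vert f = v ∧ f ∈ out
  existsUnique_in : ∀ v, ∃! f, graph.vert f = v ∧ graph.inv f ∈ out

namespace CyclicNecklace

/-- Isomorphisms of cyclically ordered necklaces with labelled legs. -/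
@[ext]
structure Hom {n : ℕ} (Γ Δ : CyclicNecklace n) : Type where
  flag : Γ.graph.Flag ≃ Δ.graph.Flag
  vert : Γ.graph.Vert ≃ Δ.graph.Vert
  vert_flag : ∀ f, Δ.graph.vert (flag f) = vert (Γ.graph.vert f)
  inv_flag : ∀ f, Δ.graph.inv (flag f) = flag (Γ.graph.inv f)
  flag_mem_out_iff : ∀ f, flag f ∈ Δ.out ↔ f ∈ Γ.out
  label_flag : ∀ (f : Γ.graph.Flag) (hf : Γ.graph.inv f = f)
    (hf' : Δ.graph.inv (flag f) = flag f), Δ.label ⟨flag f, hf'⟩ = Γ.label ⟨f, hf⟩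

/-- The groupoid of cyclically ordered necklaces with legs labelled by `{1, …, n}`. -/
instance (n : ℕ) : Category (CyclicNecklace n) where
  Hom := Hom
  id Γ := ⟨Equiv.refl _, Equiv.refl _, fun _ => rfl, fun _ => rfl, fun _ => Iff.rfl,
    fun _ _ _ => rfl⟩
  comp φ ψ :=
    { flag := φ.flag.trans ψ.flag
      vert := φ.vert.trans ψ.vert
      vert_flag := fun f => by simp [ψ.vert_flag, φ.vert_flag]
      inv_flag := fun f => by simp [ψ.inv_flag, φ.inv_flag]
      flag_mem_out_iff := fun f => by simp [ψ.flag_mem_out_iff, φ.flag_mem_out_iff]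
      label_flag := fun f hf hf' => by
        have h : _ = φ.flag f := (φ.inv_flag f).trans (congrArg φ.flag hf)
        exact (ψ.label_flag _ h hf').trans (φ.label_flag f hf h) }

/-- The bijection between the flags at `v` and those at the image of `v`. -/
def Hom.flagsAtEquiv {n : ℕ} {Γ Δ : CyclicNecklace n} (φ : Hom Γ Δ) (v : Γ.graph.Vert) :
    Γ.graph.flagsAt v ≃ Δ.graph.flagsAt (φ.vert v) :=
  φ.flag.subtypeEquiv fun f => by rw [φ.vert_flag, φ.vert.apply_eq_iff_eq]

/-- Relabelling the legs. -/
def relabel {n : ℕ} (σ : Equiv.Perm (Fin n)) (Γ : CyclicNecklace n) : CyclicNecklace n :=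
  { Γ with label := Γ.label.trans σ }

end CyclicNecklace

variable {E : Type u} [Category.{v} E] [MonoidalCategory E] [SymmetricCategory E]

/-- The object `V((Γ)) = ⨂ v, V((0, Leg(v)))` of a cyclically ordered necklace of genus zero
vertices, where `v` runs over the vertices and `Leg(v)` is the set of flags at `v`. -/
def necklaceObj (V : StableSModule E) {n : ℕ} (Γ : CyclicNecklace n) : E :=
  bigTensor fun v => V.obj 0 (Γ.graph.flagsAt v)

/-- The map `V((Γ)) ⟶ V((Δ))` induced by an isomorphism. -/
def necklaceMap (V : StableSModule E) {n : ℕ} {Γ Δ : CyclicNecklace n}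
    (φ : CyclicNecklace.Hom Γ Δ) : necklaceObj V Γ ⟶ necklaceObj V Δ :=
  tensorMap φ.vert fun v => V.map 0 (φ.flagsAtEquiv v)

theorem necklaceMap_id (V : StableSModule E) {n : ℕ} (Γ : CyclicNecklace n) :
    necklaceMap V (𝟙 Γ) = 𝟙 _ := by
  refine Eq.trans ?_ (tensorMap_id fun v => V.obj 0 (Γ.graph.flagsAt v))
  exact congrArg (tensorMap (Equiv.refl _)) (funext fun v => V.map_refl 0 (Γ.graph.flagsAt v))

theorem necklaceMap_comp (V : StableSModule E) {n : ℕ} {Γ Δ Θ : CyclicNecklace n} (φ : Γ ⟶ Δ)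
    (ψ : Δ ⟶ Θ) : necklaceMap V (φ ≫ ψ) = necklaceMap V φ ≫ necklaceMap V ψ := by
  refine Eq.symm ((tensorMap_comp _ _ _ _).trans ?_)
  exact congrArg (tensorMap (φ.vert.trans ψ.vert)) (funext fun v => V.map_trans 0 _ _)

/-- The functor `Γ ↦ V((Γ))` on cyclically ordered necklaces of genus zero vertices. -/
def necklaceFunctor (V : StableSModule E) (n : ℕ) : CyclicNecklace n ⥤ E where
  obj Γ := necklaceObj V Γ
  map φ := necklaceMap V φ
  map_id Γ := necklaceMap_id V Γ
  map_comp φ ψ := necklaceMap_comp V φ ψ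

/-- `N` is the `𝕊`-module of cyclically ordered necklaces of genus zero vertices: `N(n)` is the
colimit of `V((Γ))` over the groupoid of cyclically ordered necklaces `Γ` of genus zero vertices
with legs labelled by `{1, …, n}`, and `𝕊ₙ` acts on it by relabelling the legs. -/
structure NecklaceModule (V : StableSModule E) (N : SModule E) where
  ι : ∀ n : ℕ+, necklaceFunctor V n ⟶ (Functor.const (CyclicNecklace n)).obj (N n).V
  isColimit : ∀ n : ℕ+, IsColimit (Cocone.mk (N n).V (ι n))
  ι_relabel : ∀ (n : ℕ+) (σ : Equiv.Perm (Fin n)) (Γ : CyclicNecklace n),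
    (ι n).app Γ ≫ (N n).ρ σ = (ι n).app (Γ.relabel σ)

end Graph

end SModules

end

/-! A coset of `ℤ/k` in `𝕊ₖ` is the same as a `k`-cycle on `{1, …, k}`: send the class of `σ` to `σ
c σ⁻¹` with `c` the rotation. This is injective because the centralizer of `c` is the group
generated by `c` (`mem_zpowers_of_commute`). As the tensor product is additive, it distributes over
finite coproducts, so `Ass(k) ⊗ W^{⊗ k}(n)` is the sum of the objects `⨂ i, W(f⁻¹(i))` over pairs
`(x, f)` of a cyclic order and a surjection.

Such a triple `(k, x, f)` is a necklace: the vertices are `1, …, k`, the edges go from each vertex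
to its successor under the cycle, and the leg `s` sits at `f s`. For `W = 𝐚₀''` the two marked legs
of each factor become the two half-edges at the vertex, so the summand is `V((Γ))` (`summandIso`).
Labels and direction leave no freedom beyond the vertices: isomorphisms between two such necklaces
are exactly the permutations `σ` that carry one pair to the other (`exists_eq_permNecklaceHom`).
Taking `𝕊ₖ`-coinvariants is therefore taking the colimit over these standard necklaces.

Every necklace is isomorphic to a standard one (`exists_permNecklace`): connectedness makes the
successor permutation a single cycle, and stability puts a leg at each vertex, so that `f` is
surjective. The standard necklaces thus form a full subcategory equivalent to the whole groupoid,
and the colimit does not change. -/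

noncomputable section

namespace SModules

universe v u

/-! ### Tensor products distribute over finite coproducts -/

section TensorCoproduct

variable {E : Type u} [Category.{v} E] [HasFiniteColimits E] [Preadditive E]

-- In a preadditive category finite coproducts are biproducts. This decomposition of the identity is
-- preserved by the bilinear tensor product, which is how additivity enters the proof.
open Classical in
theorem sum_sigma_π_ι {J : Type} [Fintype J] (X : J → E) :
    ∑ j, Sigma.π X j ≫ Sigma.ι X j = 𝟙 (∐ X) := by
  refine Limits.Sigma.hom_ext _ _ fun j => ?_
  rw [Preadditive.comp_sum, Finset.sum_eq_single j, Sigma.ι_π_eq_id_assoc, Category.comp_id]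
  · intro i _ hi
    rw [Sigma.ι_π_of_ne_assoc _ hi.symm, zero_comp]
  · simp

variable [MonoidalCategory E] [MonoidalPreadditive E]

theorem tensor_sigma_hom_ext {J K : Type} [Finite J] [Finite K] {X : J → E} {Y : K → E} {Z : E}
    {f g : (∐ X) ⊗ (∐ Y) ⟶ Z}
    (h : ∀ j k, (Sigma.ι X j ⊗ₘ Sigma.ι Y k) ≫ f = (Sigma.ι X j ⊗ₘ Sigma.ι Y k) ≫ g) : f = g := by
  have := Fintype.ofFinite J
  have := Fintype.ofFinite K
  rw [← Category.id_comp f, ← Category.id_comp g, ← id_tensorHom_id, ← sum_sigma_π_ι X,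
    ← sum_sigma_π_ι Y]
  simp only [sum_tensor, tensor_sum, Preadditive.sum_comp, ← tensorHom_comp_tensorHom,
    Category.assoc, h]

open Classical in
/-- A map out of a tensor product of two coproducts, given on the summands. -/
def tensorSigmaDesc {J K : Type} [Finite J] [Finite K] {X : J → E} {Y : K → E} {Z : E}
    (t : ∀ j k, X j ⊗ Y k ⟶ Z) : (∐ X) ⊗ (∐ Y) ⟶ Z :=
  have := Fintype.ofFinite J
  have := Fintype.ofFinite K
  ∑ j, ∑ k, (Sigma.π X j ⊗ₘ Sigma.π Y k) ≫ t j k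

theorem ι_tensorSigmaDesc {J K : Type} [Finite J] [Finite K] {X : J → E} {Y : K → E} {Z : E}
    (t : ∀ j k, X j ⊗ Y k ⟶ Z) (j : J) (k : K) :
    (Sigma.ι X j ⊗ₘ Sigma.ι Y k) ≫ tensorSigmaDesc t = t j k := by
  classical
  rw [tensorSigmaDesc]
  simp only [Preadditive.comp_sum]
  rw [Finset.sum_eq_single j, Finset.sum_eq_single k, tensorHom_comp_tensorHom_assoc,
    Sigma.ι_π_eq_id, Sigma.ι_π_eq_id, id_tensorHom_id, Category.id_comp]
  · intro l _ hl
    rw [tensorHom_comp_tensorHom_assoc, Sigma.ι_π_of_ne Y hl.symm, MonoidalPreadditive.tensor_zero,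
      zero_comp]
  · simp
  · intro i _ hi
    refine Finset.sum_eq_zero fun l _ => ?_
    rw [tensorHom_comp_tensorHom_assoc, Sigma.ι_π_of_ne X hi.symm, MonoidalPreadditive.zero_tensor,
      zero_comp]
  · simp

end TensorCoproduct

/-! ### Universal properties of direct sums and coinvariants -/

section Representations

variable {E : Type u} [Category.{v} E] [HasFiniteColimits E]

/-- The inclusion of a summand into a direct sum. -/
def directSumInj {G : Type} [Group G] {ι : Type} [Finite ι] (X : ι → Action E G) (i : ι) :
    (X i).V ⟶ (directSum X).V :=
  Sigma.ι (fun i => (X i).V) i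

theorem directSumInj_ρ {G : Type} [Group G] {ι : Type} [Finite ι] (X : ι → Action E G) (i : ι)
    (g : G) : directSumInj X i ≫ (directSum X).ρ g = (X i).ρ g ≫ directSumInj X i :=
  Limits.Sigma.ι_map (fun i => (X i).ρ g) i

theorem directSum_hom_ext {G : Type} [Group G] {ι : Type} [Finite ι] {X : ι → Action E G} {Z : E}
    {p q : (directSum X).V ⟶ Z} (h : ∀ i, directSumInj X i ≫ p = directSumInj X i ≫ q) : p = q :=
  Limits.Sigma.hom_ext _ _ h

theorem exists_directSum_desc {G : Type} [Group G] {ι : Type} [Finite ι] (X : ι → Action E G)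
    {Z : E} (t : ∀ i, (X i).V ⟶ Z) : ∃ p : (directSum X).V ⟶ Z, ∀ i, directSumInj X i ≫ p = t i :=
  ⟨Limits.Sigma.desc t, fun i => Limits.Sigma.ι_desc t i⟩

/-- The projection to the coinvariants. -/
def coinvariantsProj {G H : Type} [Group G] [Finite G] [Group H] (X : Action E (G × H)) :
    X.V ⟶ (coinvariants X).V :=
  colimit.ι (leftDiagram X) (SingleObj.star G)

theorem ρ_coinvariantsProj {G H : Type} [Group G] [Finite G] [Group H] (X : Action E (G × H))
    (g : G) : X.ρ (g, 1) ≫ coinvariantsProj X = coinvariantsProj X :=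
  colimit.w (leftDiagram X) (j := SingleObj.star G) (j' := SingleObj.star G) g

theorem coinvariantsProj_ρ {G H : Type} [Group G] [Finite G] [Group H] (X : Action E (G × H))
    (h : H) : coinvariantsProj X ≫ (coinvariants X).ρ h = X.ρ (1, h) ≫ coinvariantsProj X :=
  ι_colimMap (leftDiagramMap X h) (SingleObj.star G)

theorem coinvariants_hom_ext {G H : Type} [Group G] [Finite G] [Group H] {X : Action E (G × H)}
    {Z : E} {p q : (coinvariants X).V ⟶ Z}
    (h : coinvariantsProj X ≫ p = coinvariantsProj X ≫ q) : p = q :=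
  colimit.hom_ext fun _ => h

theorem exists_coinvariants_desc {G H : Type} [Group G] [Finite G] [Group H]
    (X : Action E (G × H)) {Z : E} (t : X.V ⟶ Z) (ht : ∀ g : G, X.ρ (g, 1) ≫ t = t) :
    ∃ p : (coinvariants X).V ⟶ Z, coinvariantsProj X ≫ p = t :=
  ⟨colimit.desc (leftDiagram X) ⟨Z, ⟨fun _ => t, fun _ _ g =>
    (ht g).trans (Category.comp_id _).symm⟩⟩, colimit.ι_desc _ _⟩

end Representations

/-! ### The summands of `(Ass ∘ W)(n)` and its universal property -/

section AssPlethysm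

theorem Surj.act_apply {n k : ℕ} (g : Equiv.Perm (Fin k) × Equiv.Perm (Fin n)) (f : Surj n k)
    (s : Fin n) : (f.act g).1 (g.2 s) = g.1 (f.1 s) := by
  simp [Surj.act]

variable {E : Type u} [Category.{v} E] [HasFiniteColimits E] [MonoidalCategory E]

/-- The cosets of `ℤ/k` in `𝕊ₖ`: the cyclic orders on `{1, …, k}`. -/
abbrev CycCoset (k : ℕ) : Type := Equiv.Perm (Fin k) ⧸ Subgroup.zpowers (finRotate k)

variable (E) in
/-- The inclusion of a summand into `Ass(k)`. -/
def cosetInj {k : ℕ} (x : CycCoset k) :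
    𝟙_ E ⟶ (indTrivial E (Subgroup.zpowers (finRotate k))).V :=
  Sigma.ι (fun _ : CycCoset k => 𝟙_ E) x

theorem cosetInj_ρ {k : ℕ} (x : CycCoset k) (σ : Equiv.Perm (Fin k)) :
    cosetInj E x ≫ (indTrivial E (Subgroup.zpowers (finRotate k))).ρ σ = cosetInj E (σ • x) :=
  Limits.Sigma.ι_desc _ _

variable [SymmetricCategory E]

/-- The inclusion of a summand into `W^{⊗ k}(n)`. -/
def powInj (W : SModule E) {n k : ℕ} (f : Surj n k) : powSummand W f ⟶ (tensorPow W k n).V :=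
  Sigma.ι (fun f : Surj n k => powSummand W f) f

theorem powInj_ρ (W : SModule E) {n k : ℕ} (f : Surj n k)
    (g : Equiv.Perm (Fin k) × Equiv.Perm (Fin n)) :
    powInj W f ≫ (tensorPow W k n).ρ g =
      powSummandMap W g.1 g.2 (f.act_apply g) ≫ powInj W (f.act g) :=
  Limits.Sigma.ι_desc _ _

/-- The representation `Ass(k) ⊗ W^{⊗ k}(n)` of `𝕊ₖ × 𝕊ₙ`. -/
abbrev assTensor (W : SModule E) (k n : ℕ) : Action E (Equiv.Perm (Fin k) × Equiv.Perm (Fin n)) :=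
  diagTensor (indTrivial E (Subgroup.zpowers (finRotate k))) (tensorPow W k n)

/-- The inclusion `𝟙 ⊗ ⨂ i, W(f⁻¹(i)) ⟶ Ass(k) ⊗ W^{⊗ k}(n)`. -/
def assTensorPair (W : SModule E) {k n : ℕ} (x : CycCoset k) (f : Surj n k) :
    𝟙_ E ⊗ powSummand W f ⟶ (assTensor W k n).V :=
  cosetInj E x ⊗ₘ powInj W f

theorem assTensorPair_ρ (W : SModule E) {k n : ℕ} (g : Equiv.Perm (Fin k) × Equiv.Perm (Fin n))
    (x : CycCoset k) (f : Surj n k) :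
    assTensorPair W x f ≫ (assTensor W k n).ρ g =
      𝟙_ E ◁ powSummandMap W g.1 g.2 (f.act_apply g) ≫ assTensorPair W (g.1 • x) (f.act g) := by
  refine (tensorHom_comp_tensorHom _ _ _ _).trans
      ((congrArg₂ (· ⊗ₘ ·) (cosetInj_ρ x g.1) (powInj_ρ W f g)).trans ?_)
  refine Eq.trans ?_ (congrArg (· ≫ (cosetInj E (g.1 • x) ⊗ₘ powInj W (f.act g)))
    (id_tensorHom (𝟙_ E) (powSummandMap W g.1 g.2 (f.act_apply g))))
  refine Eq.trans ?_ (tensorHom_comp_tensorHom _ _ _ _).symm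
  exact congrArg (· ⊗ₘ _) (Category.id_comp _).symm

/-- The inclusion of a summand `⨂ i, W(f⁻¹(i))` into `Ass(k) ⊗ W^{⊗ k}(n)`. -/
def assTensorInj (W : SModule E) {k n : ℕ} (x : CycCoset k) (f : Surj n k) :
    powSummand W f ⟶ (assTensor W k n).V :=
  (λ_ _).inv ≫ assTensorPair W x f

theorem assTensorInj_ρ (W : SModule E) {k n : ℕ} (g : Equiv.Perm (Fin k) × Equiv.Perm (Fin n))
    (x : CycCoset k) (f : Surj n k) :
    assTensorInj W x f ≫ (assTensor W k n).ρ g =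
      powSummandMap W g.1 g.2 (f.act_apply g) ≫ assTensorInj W (g.1 • x) (f.act g) := by
  refine (Category.assoc _ _ _).trans ((congrArg (_ ≫ ·) (assTensorPair_ρ W g x f)).trans ?_)
  rw [assTensorInj, leftUnitor_inv_naturality_assoc]

/-- The inclusion of a summand `⨂ i, W(f⁻¹(i))` into `(Ass ∘ W)(n)`. -/
def assInj (W : SModule E) {n : ℕ+} (k : Set.Iic n) (x : CycCoset (k : ℕ+))
    (f : Surj n (k : ℕ+)) : powSummand W f ⟶ (plethysm (Ass E) W n).V :=
  assTensorInj W x f ≫ coinvariantsProj (assTensor W (k : ℕ+) n) ≫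
    directSumInj (fun k : Set.Iic n => coinvariants (assTensor W (k : ℕ+) n)) k

/-- Passing to coinvariants identifies the summand of `(x, f)` with that of `(σ x, σ f)`; by
`exists_ass_desc` these are all the relations. -/
theorem powSummandMap_assInj (W : SModule E) {n : ℕ+} (k : Set.Iic n)
    (σ : Equiv.Perm (Fin (k : ℕ+))) (x : CycCoset (k : ℕ+)) (f : Surj n (k : ℕ+)) :
    powSummandMap W σ 1 (f.act_apply (σ, 1)) ≫ assInj W k (σ • x) (f.act (σ, 1)) =
      assInj W k x f := by
  refine (Category.assoc _ _ _).symm.trans ?_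
  refine (congrArg (· ≫ _) (assTensorInj_ρ W (σ, 1) x f).symm).trans ?_
  refine (Category.assoc _ _ _).trans ?_
  refine congrArg (_ ≫ ·) ((Category.assoc _ _ _).symm.trans ?_)
  exact congrArg (· ≫ _) (ρ_coinvariantsProj _ σ)

/-- The index `1 • x` is left unsimplified so that it matches the action of the pair `(1, τ)` on
indices without transport. -/
theorem assInj_ρ (W : SModule E) {n : ℕ+} (k : Set.Iic n)
    (τ : Equiv.Perm (Fin n)) (x : CycCoset (k : ℕ+)) (f : Surj n (k : ℕ+)) :
    assInj W k x f ≫ (plethysm (Ass E) W n).ρ τ =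
      powSummandMap W 1 τ (f.act_apply (1, τ)) ≫
        assInj W k ((1 : Equiv.Perm (Fin (k : ℕ+))) • x) (f.act (1, τ)) := by
  have h := assTensorInj_ρ W (1, τ) x f
  refine (Category.assoc _ _ _).trans ?_
  refine (congrArg (_ ≫ ·) ((Category.assoc _ _ _).trans (congrArg (_ ≫ ·) (directSumInj_ρ
    (fun k : Set.Iic n => coinvariants (assTensor W (k : ℕ+) n)) k τ)))).trans ?_
  refine (congrArg (_ ≫ ·) ((Category.assoc _ _ _).symm.trans (congrArg (· ≫ _)
    (coinvariantsProj_ρ (assTensor W (k : ℕ+) n) τ)))).trans ?_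
  refine (congrArg (_ ≫ ·) (Category.assoc _ _ _)).trans ((Category.assoc _ _ _).symm.trans ?_)
  exact (congrArg (· ≫ _) h).trans (Category.assoc _ _ _)

variable [Preadditive E] [MonoidalPreadditive E]

theorem assTensor_hom_ext (W : SModule E) {k n : ℕ} {Z : E} {p q : (assTensor W k n).V ⟶ Z}
    (h : ∀ x f, assTensorInj W x f ≫ p = assTensorInj W x f ≫ q) : p = q := by
  refine tensor_sigma_hom_ext fun x f => ?_
  refine (cancel_epi (λ_ _).inv).1 ?_
  exact (Category.assoc _ _ _).symm.trans ((h x f).trans (Category.assoc _ _ _))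

theorem exists_assTensor_desc (W : SModule E) {k n : ℕ} {Z : E}
    (t : ∀ (_ : CycCoset k) (f : Surj n k), powSummand W f ⟶ Z) :
    ∃ p : (assTensor W k n).V ⟶ Z, ∀ x f, assTensorInj W x f ≫ p = t x f := by
  refine ⟨tensorSigmaDesc (X := fun _ : CycCoset k => 𝟙_ E)
    (Y := fun f : Surj n k => powSummand W f) fun x f => (λ_ _).hom ≫ t x f, fun x f => ?_⟩
  refine (Category.assoc _ _ _).trans ?_
  exact (congrArg ((λ_ _).inv ≫ ·) (ι_tensorSigmaDesc _ x f)).trans (Iso.inv_hom_id_assoc _ _)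

theorem assInj_hom_ext (W : SModule E) {n : ℕ+} {Z : E} {p q : (plethysm (Ass E) W n).V ⟶ Z}
    (h : ∀ k x f, assInj W k x f ≫ p = assInj W k x f ≫ q) : p = q := by
  refine directSum_hom_ext fun k => coinvariants_hom_ext (assTensor_hom_ext W fun x f => ?_)
  have e (r : (plethysm (Ass E) W n).V ⟶ Z) : assInj W k x f ≫ r = assTensorInj W x f ≫
      coinvariantsProj (assTensor W (k : ℕ+) n) ≫
        directSumInj (fun k : Set.Iic n => coinvariants (assTensor W (k : ℕ+) n)) k ≫ r :=
    (Category.assoc _ _ _).trans (congrArg (_ ≫ ·) (Category.assoc _ _ _))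
  exact (e p).symm.trans ((h k x f).trans (e q))

theorem exists_ass_desc (W : SModule E) {n : ℕ+} {Z : E}
    (t : ∀ (k : Set.Iic n) (_ : CycCoset (k : ℕ+)) (f : Surj n (k : ℕ+)), powSummand W f ⟶ Z)
    (ht : ∀ (k : Set.Iic n) (σ : Equiv.Perm (Fin (k : ℕ+))) (x : CycCoset (k : ℕ+))
      (f : Surj n (k : ℕ+)), powSummandMap W σ 1 (f.act_apply (σ, 1)) ≫
        t k (σ • x) (f.act (σ, 1)) = t k x f) :
    ∃ p : (plethysm (Ass E) W n).V ⟶ Z, ∀ k x f, assInj W k x f ≫ p = t k x f := by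
  choose d hd using fun k : Set.Iic n => exists_assTensor_desc W (t k)
  choose c hc using fun k : Set.Iic n => exists_coinvariants_desc (assTensor W (k : ℕ+) n) (d k)
    fun σ => by
      refine assTensor_hom_ext W fun x f => ?_
      refine (Category.assoc _ _ _).symm.trans
        ((congrArg (· ≫ _) (assTensorInj_ρ W (σ, 1) x f)).trans ?_)
      refine (Category.assoc _ _ _).trans ?_
      exact (congrArg (_ ≫ ·) (hd k _ _)).trans ((ht k σ x f).trans (hd k x f).symm)
  obtain ⟨p, hp⟩ := exists_directSum_desc
    (fun k : Set.Iic n => coinvariants (assTensor W (k : ℕ+) n)) c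
  refine ⟨p, fun k x f => ?_⟩
  rw [← hd, ← hc, ← hp]
  exact (Category.assoc _ _ _).trans (congrArg (_ ≫ ·) (Category.assoc _ _ _))

end AssPlethysm

/-! ### The two marked legs of `𝐚₀''` -/

section MarkedLegs

variable {E : Type u} [Category.{v} E]

/-- The numbering of `S ⊔ {two marked legs}` that extends a numbering of `S`. -/
def numberMarked {S : Type} {n : ℕ} (e : S ≃ Fin n) : S ⊕ Bool ≃ Fin (n + 2) :=
  (e.sumCongr finTwoEquiv.symm).trans finSumFinEquiv

/-- Restriction to `𝕊ₙ` extends a permutation by fixing the last two points. Under `numberMarked`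
these are the points of `Bool`, so the extended permutation is the one induced by `e ⊔ id`. -/
theorem extMap_aZeroSecond (V : StableSModule E) {S T : Type} {i j : ℕ+} (h : i = j)
    (eS : S ≃ Fin i) (eT : T ≃ Fin j) (e : S ≃ T) (h' : (i : ℕ) + 2 = j + 2) :
    extMap (d := fun n : ℕ+ => (n : ℕ)) (aZeroSecond V) h eS eT e =
      extMap (d := fun n : ℕ => n) (V.rep 0) h' (numberMarked eS) (numberMarked eT)
        (e.sumCongr (Equiv.refl Bool)) := by
  subst h
  have : Equiv.Perm.viaEmbeddingHom (Fin.castAddEmb (n := (i : ℕ)) 2)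
      ((finCongr (congrArg (fun n : ℕ+ => (n : ℕ)) (Eq.refl i))).symm.trans
        (eS.symm.trans (e.trans eT))) =
      (finCongr (congrArg (fun n : ℕ => n) h')).symm.trans ((numberMarked eS).symm.trans
        ((e.sumCongr (Equiv.refl Bool)).trans (numberMarked eT))) := by
    ext x
    refine congrArg Fin.val ?_
    rw [Equiv.Perm.viaEmbeddingHom_apply]
    induction x using Fin.addCases with
    | left x =>
      refine (Equiv.Perm.viaEmbedding_apply _ (Fin.castAddEmb (n := (i : ℕ)) 2) x).trans ?_
      simp [numberMarked]
    | right x =>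
      rw [Equiv.Perm.viaEmbedding_apply_of_notMem]
      · simp [numberMarked]
      · rintro ⟨y, hy⟩
        have := congrArg Fin.val hy
        simp at this
        lia
  exact congrArg (fun p => 𝟙 _ ≫ (V.rep 0 ((i : ℕ) + 2)).ρ p) this

theorem card_marked {S T : Type} [Finite S] (u : S ⊕ Bool ≃ T) :
    Nat.card S + 2 = Nat.card T := by
  rw [← Nat.card_congr u, Nat.card_sum]
  simp

/-- The identification `𝐚₀''(S) ⟶ V((0, T))` for a finite set `T` that consists of `S` and two more
elements. -/
def markedHom (V : StableSModule E) {S T : Type} [Finite S] [Nonempty S] [Finite T]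
    (u : S ⊕ Bool ≃ T) : SModule.obj (aZeroSecond V) S ⟶ V.obj 0 T :=
  extMap (d := fun n : ℕ => n) (V.rep 0) (card_marked u) (numberMarked (Finite.equivFin S))
    (Finite.equivFin T) u

/-- The inverse of `markedHom`. -/
def markedInv (V : StableSModule E) {S T : Type} [Finite S] [Nonempty S] [Finite T]
    (u : S ⊕ Bool ≃ T) : V.obj 0 T ⟶ SModule.obj (aZeroSecond V) S :=
  extMap (d := fun n : ℕ => n) (V.rep 0) (card_marked u).symm (Finite.equivFin T)
    (numberMarked (Finite.equivFin S)) u.symm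

theorem markedHom_markedInv (V : StableSModule E) {S T : Type} [Finite S] [Nonempty S] [Finite T]
    (u : S ⊕ Bool ≃ T) : markedHom V u ≫ markedInv V u = 𝟙 _ := by
  refine (extMap_comp _ _ _ rfl _ _ _ _ _).trans ?_
  rw [Equiv.self_trans_symm]
  exact extMap_refl _ _ _

theorem markedInv_markedHom (V : StableSModule E) {S T : Type} [Finite S] [Nonempty S] [Finite T]
    (u : S ⊕ Bool ≃ T) : markedInv V u ≫ markedHom V u = 𝟙 _ := by
  refine (extMap_comp _ _ _ rfl _ _ _ _ _).trans ?_
  rw [Equiv.symm_trans_self]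
  exact extMap_refl _ _ _

/-- All four maps are values of `extMap` for `V.rep 0`, so the square commutes as soon as the square
of bijections does. -/
theorem map_markedHom (V : StableSModule E) {S S' T T' : Type} [Finite S] [Nonempty S] [Finite T]
    [Finite S'] [Nonempty S'] [Finite T'] (u : S ⊕ Bool ≃ T) (u' : S' ⊕ Bool ≃ T') (e : S ≃ S')
    (e' : T ≃ T') (h : (e.sumCongr (Equiv.refl Bool)).trans u' = u.trans e') :
    SModule.map (aZeroSecond V) e ≫ markedHom V u' = markedHom V u ≫ V.map 0 e' := by
  have h' : Nat.card S + 2 = Nat.card T' := card_marked (u.trans e')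
  have h₁ := extMap_aZeroSecond V (i := ⟨Nat.card S, Nat.card_pos⟩)
    (j := ⟨Nat.card S', Nat.card_pos⟩) (PNat.eq (Nat.card_congr e)) (Finite.equivFin S)
    (Finite.equivFin S') e (congrArg (· + 2) (Nat.card_congr e))
  refine (congrArg (· ≫ _) h₁).trans ?_
  refine (extMap_comp _ _ _ h' _ _ _ _ _).trans ?_
  rw [h]
  exact (extMap_comp _ _ _ h' _ _ _ _ _).symm

end MarkedLegs

/-- A cycle stays connected when the link from `v` to `c v` is missing: walk from `c v` around to
`v`. The exception at `v` lets the lemma serve both the necklace and the necklace with an edge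
removed. -/
theorem FlagGraph.connected_of_perm (G : FlagGraph) (c : Equiv.Perm G.Vert)
    (hc : ∀ v w, ∃ m : ℕ, (c ^ m) v = w) (v : G.Vert)
    (h : ∀ w ≠ v, Quot.mk G.Adj w = Quot.mk G.Adj (c w)) : G.Connected := by
  have key (m : ℕ) : Quot.mk G.Adj ((c ^ m) (c v)) = Quot.mk G.Adj (c v) := by
    induction m with
    | zero => rfl
    | succ m ih =>
      rw [pow_succ', Equiv.Perm.mul_apply]
      -- If the walk has reached `v`, its next vertex is the starting point `c v`, so the missing
      -- link is not needed.
      by_cases hv : (c ^ m) (c v) = v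
      · rw [hv]
      · rw [← h _ hv, ih]
  refine Nat.card_eq_one_iff_unique.2 ⟨⟨fun x y => ?_⟩, ⟨Quot.mk _ v⟩⟩
  induction x using Quot.ind with | mk x =>
  induction y using Quot.ind with | mk y =>
  obtain ⟨m, rfl⟩ := hc (c v) x
  obtain ⟨m', rfl⟩ := hc (c v) y
  rw [key, key]

/-! ### Standard necklaces on the vertices `1, …, k` -/

section StandardNecklace

variable {n k : ℕ}

/-- The graph with vertices `1, …, k`, edges from `i` to `c i`, and legs `1, …, n`, where the leg
`s` is attached to the vertex `f s`. The flags `(i, true)` and `(i, false)` are the halves at `i` of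
the edges that start and end there. -/
def permGraph (c : Equiv.Perm (Fin k)) (f : Fin n → Fin k) : FlagGraph where
  Flag := Fin n ⊕ Fin k × Bool
  Vert := Fin k
  vert := Sum.elim f Prod.fst
  inv x := match x with
    | .inl s => .inl s
    | .inr (i, true) => .inr (c i, false)
    | .inr (i, false) => .inr (c.symm i, true)
  inv_inv x := by
    rcases x with s | ⟨i, _ | _⟩ <;> simp

theorem permGraph_inv_ne (c : Equiv.Perm (Fin k)) (f : Fin n → Fin k) (i : Fin k) (b : Bool) :
    (permGraph c f).inv (.inr (i, b)) ≠ .inr (i, b) := by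
  cases b <;> simp [permGraph]

theorem permGraph_adj (c : Equiv.Perm (Fin k)) (f : Fin n → Fin k) (i : Fin k) :
    (permGraph c f).Adj i (c i) :=
  ⟨.inr (i, true), permGraph_inv_ne c f i true, rfl, rfl⟩

theorem permGraph_removeEdge_adj (c : Equiv.Perm (Fin k)) (f : Fin n → Fin k) {i j : Fin k}
    (hij : j ≠ i) {x : (permGraph c f).Flag}
    (hx : x = .inr (i, true) ∨ x = .inr (c i, false)) :
    ((permGraph c f).removeEdge x).Adj j (c j) := by
  have h₁ : (Sum.inr (j, true) : Fin n ⊕ Fin k × Bool) ≠ .inr (i, true) := by simpa using hij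
  have h₂ : (Sum.inr (j, true) : Fin n ⊕ Fin k × Bool) ≠ .inr (c i, false) := by simp
  -- Removing the edge through its target flag `(c i, false)` also deletes the opposite flag, which
  -- the involution gives as `(c.symm (c i), true)`.
  have h₃ : (Sum.inr (j, true) : Fin n ⊕ Fin k × Bool) ≠ .inr (c.symm (c i), true) := by
    simpa using hij
  refine ⟨⟨.inr (j, true), ?_, ?_⟩, ?_, rfl, rfl⟩
  · rcases hx with rfl | rfl
    · exact h₁
    · exact h₂
  · rcases hx with rfl | rfl
    · exact h₂
    · exact h₃
  · exact fun h => permGraph_inv_ne c f j true (congrArg Subtype.val h)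

/-- Each edge has exactly one flag marked `true`, and that flag recovers its source. The count thus
includes the loop for `k = 1` and the double edge for `k = 2`. -/
theorem permGraph_edge_card (c : Equiv.Perm (Fin k)) (f : Fin n → Fin k) :
    Nat.card (permGraph c f).Edge = k := by
  let F (i : Fin k) : (permGraph c f).Edge :=
    ⟨{.inr (i, true), .inr (c i, false)}, .inr (i, true), permGraph_inv_ne c f i true, rfl⟩
  have hF : Function.Bijective F := by
    constructor
    · intro i j h
      have h₁ : (Sum.inr (i, true) : Fin n ⊕ Fin k × Bool) ∈ (F j).1 := by
        rw [← h]; exact Or.inl rfl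
      rcases h₁ with h₁ | h₁
      · exact (Prod.ext_iff.1 (Sum.inr_injective h₁)).1
      · exact absurd (Prod.ext_iff.1 (Sum.inr_injective h₁)).2 (by simp)
    · rintro ⟨_, x, hx, rfl⟩
      rcases x with s | ⟨i, _ | _⟩
      · exact absurd rfl hx
      · refine ⟨c.symm i, Subtype.ext ?_⟩
        refine (Set.pair_comm _ _).trans ?_
        simp [permGraph]
      · exact ⟨i, rfl⟩
  rw [← Nat.card_congr (Equiv.ofBijective F hF), Nat.card_fin]

theorem permGraph_isNecklace (c : Equiv.Perm (Fin k)) (hk : 0 < k)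
    (hc : ∀ i j, ∃ m : ℕ, (c ^ m) i = j) (f : Fin n → Fin k) : (permGraph c f).IsNecklace := by
  have h : (permGraph c f).Connected :=
    FlagGraph.connected_of_perm _ c hc (⟨0, hk⟩ : Fin k) fun i _ => Quot.sound (permGraph_adj c f i)
  refine ⟨h, ?_, fun x hx => ?_⟩
  · rw [FlagGraph.b₁, permGraph_edge_card, h]
    have : Nat.card (permGraph c f).Vert = k := Nat.card_fin k
    simp [this]
  · obtain ⟨i, hi⟩ : ∃ i, x = .inr (i, true) ∨ x = .inr (c i, false) := by
      rcases x with s | ⟨i, _ | _⟩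
      · exact absurd rfl hx
      · exact ⟨c.symm i, Or.inr (by rw [Equiv.apply_symm_apply])⟩
      · exact ⟨i, Or.inl rfl⟩
    exact FlagGraph.connected_of_perm _ c hc i fun j hj =>
      Quot.sound (permGraph_removeEdge_adj c f hj hi)

/-- The flags at a vertex are the legs and two halves of edges. -/
def permGraphFlagsAt (c : Equiv.Perm (Fin k)) (f : Surj n k) (i : Fin k) :
    f.Fiber i ⊕ Bool ≃ (permGraph c f.1).flagsAt i where
  toFun := Sum.elim (fun s => ⟨.inl s.1, s.2⟩) fun b => ⟨.inr (i, b), rfl⟩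
  invFun x := match x with
    | ⟨.inl s, h⟩ => .inl ⟨s, h⟩
    | ⟨.inr x, _⟩ => .inr x.2
  left_inv x := by rcases x with s | b <;> rfl
  right_inv x := by
    rcases x with ⟨s | ⟨j, b⟩, h⟩
    · rfl
    · obtain rfl : j = i := h
      rfl

/-- The legs of the graph are `1, …, n`. -/
def permGraphLabel (c : Equiv.Perm (Fin k)) (f : Fin n → Fin k) : (permGraph c f).Leg ≃ Fin n where
  toFun x := match x with
    | ⟨.inl s, _⟩ => s
    | ⟨.inr (i, b), h⟩ => (permGraph_inv_ne c f i b h).elim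
  invFun s := ⟨.inl s, rfl⟩
  left_inv x := by
    rcases x with ⟨s | ⟨i, b⟩, h⟩
    · rfl
    · exact (permGraph_inv_ne c f i b h).elim
  right_inv _ := rfl

/-- The cyclically ordered necklace with edges from `i` to `c i` and the leg `s` at `f s`. -/
def permNecklace (c : Equiv.Perm (Fin k)) (hk : 0 < k) (hc : ∀ i j, ∃ m : ℕ, (c ^ m) i = j)
    (f : Surj n k) : CyclicNecklace n where
  graph := permGraph c f.1
  isNecklace := permGraph_isNecklace c hk hc f.1
  -- Surjectivity of `f` gives stability: one leg at least, and two half-edges.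
  stable (i : Fin k) := by
    have h₁ := card_marked (permGraphFlagsAt c f i)
    have h₂ : 0 < Nat.card (f.Fiber i) := Nat.card_pos
    exact le_of_le_of_eq (by lia) h₁
  label := permGraphLabel c f.1
  out := {x | ∃ i, x = .inr (i, true)}
  inv_ne_of_mem_out := by
    rintro _ ⟨i, rfl⟩
    exact permGraph_inv_ne c f.1 i true
  inv_mem_out_iff x hx := by
    rcases x with s | ⟨i, _ | _⟩
    · exact absurd rfl hx
    · exact Iff.intro (fun _ ⟨_, h⟩ => by cases h) (fun _ => ⟨_, rfl⟩)
    · exact Iff.intro (fun ⟨_, h⟩ => by cases h) (fun h => (h ⟨_, rfl⟩).elim)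
  existsUnique_out i := by
    refine ⟨.inr (i, true), ⟨rfl, i, rfl⟩, ?_⟩
    rintro _ ⟨h, j, rfl⟩
    obtain rfl : j = i := h
    rfl
  existsUnique_in i := by
    refine ⟨.inr (i, false), ⟨rfl, c.symm i, rfl⟩, ?_⟩
    rintro x ⟨h, j, hj⟩
    rcases x with s | ⟨l, _ | _⟩
    · cases hj
    · obtain rfl : l = i := h
      rfl
    · simp [permGraph] at hj

variable {c c' : Equiv.Perm (Fin k)} {hk : 0 < k} {hc : ∀ i j, ∃ m : ℕ, (c ^ m) i = j}
  {hc' : ∀ i j, ∃ m : ℕ, (c' ^ m) i = j} {f f' : Surj n k}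

/-- The isomorphism of necklaces given by permutations of the vertices and of the legs. -/
def permNecklaceHom (σ : Equiv.Perm (Fin k)) (τ : Equiv.Perm (Fin n))
    (hf : ∀ s, f'.1 (τ s) = σ (f.1 s)) (hσ : ∀ i, σ (c i) = c' (σ i)) :
    (permNecklace c hk hc f).relabel τ ⟶ permNecklace c' hk hc' f' where
  flag := τ.sumCongr (σ.prodCongr (Equiv.refl Bool))
  vert := σ
  vert_flag x := by
    rcases x with s | x
    · exact hf s
    · rfl
  inv_flag x := by
    rcases x with s | ⟨i, _ | _⟩
    · rfl
    · refine congrArg (fun j => Sum.inr (j, true)) ?_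
      refine (Equiv.symm_apply_eq _).2 ?_
      simp [← hσ]
    · exact congrArg (fun j => Sum.inr (j, false)) (hσ i).symm
  flag_mem_out_iff x := by
    rcases x with s | ⟨i, b⟩
    · exact Iff.intro (fun ⟨_, h⟩ => by cases h) (fun ⟨_, h⟩ => by cases h)
    · refine Iff.intro (fun ⟨j, h⟩ => ⟨i, ?_⟩) (fun ⟨j, h⟩ => ⟨σ i, ?_⟩)
      · exact congrArg (fun b => Sum.inr (i, b)) (Prod.ext_iff.1 (Sum.inr_injective h)).2
      · exact congrArg (fun b => Sum.inr (σ i, b)) (Prod.ext_iff.1 (Sum.inr_injective h)).2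
  label_flag x hx hx' := by
    rcases x with s | ⟨i, b⟩
    · rfl
    · exact (permGraph_inv_ne c f.1 i b hx).elim

/-- The labels fix the legs, and the direction tells apart the two half-edges at a vertex, so the
vertex map determines everything. Relabelling by `1` changes nothing definitionally, which lets
`permNecklaceHom` with `τ = 1` be compared with `φ`. -/
theorem exists_eq_permNecklaceHom
    (φ : permNecklace c hk hc f ⟶ permNecklace c' hk hc' f') :
    ∃ (σ : Equiv.Perm (Fin k)) (hf : ∀ s, f'.1 ((1 : Equiv.Perm (Fin n)) s) = σ (f.1 s))
      (hσ : ∀ i, σ (c i) = c' (σ i)),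
        φ = permNecklaceHom (hk := hk) (hc := hc) (hc' := hc') σ 1 hf hσ := by
  have hleg (s : Fin n) : φ.flag (.inl s) = .inl s := by
    have h' : (permGraph c' f'.1).inv (φ.flag (.inl s)) = φ.flag (.inl s) := φ.inv_flag (.inl s)
    have h := φ.label_flag (.inl s) rfl h'
    exact congrArg Subtype.val ((permGraphLabel c' f'.1).eq_symm_apply.2 h)
  have hout (i : Fin k) : φ.flag (.inr (i, true)) = .inr (φ.vert i, true) := by
    obtain ⟨j, hj⟩ := (φ.flag_mem_out_iff (.inr (i, true))).2 ⟨i, rfl⟩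
    have h := φ.vert_flag (.inr (i, true))
    rw [hj] at h ⊢
    exact congrArg (fun j => Sum.inr (j, true)) h
  have hin (i : Fin k) : φ.flag (.inr (c i, false)) = .inr (c' (φ.vert i), false) := by
    have h := φ.inv_flag (.inr (i, true))
    rw [hout] at h
    exact h.symm
  have hσ (i : Fin k) : φ.vert (c i) = c' (φ.vert i) := by
    have h := φ.vert_flag (.inr (c i, false))
    rw [hin] at h
    exact h.symm
  have hf (s : Fin n) : f'.1 s = φ.vert (f.1 s) := by
    have h := φ.vert_flag (.inl s)
    rw [hleg] at h
    exact h
  refine ⟨φ.vert, hf, hσ, CyclicNecklace.Hom.ext (Equiv.ext fun x => ?_) rfl⟩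
  rcases x with s | ⟨i, _ | _⟩
  · exact hleg s
  · obtain ⟨i, rfl⟩ := c.surjective i
    refine (hin i).trans ?_
    rw [← hσ]
    rfl
  · exact hout i

end StandardNecklace

/-! ### Arbitrary necklaces are isomorphic to standard ones -/

namespace CyclicNecklace

variable {n : ℕ}

/-- The inverse of an isomorphism of necklaces. -/
def Hom.symm {Γ Δ : CyclicNecklace n} (φ : Hom Γ Δ) : Hom Δ Γ where
  flag := φ.flag.symm
  vert := φ.vert.symm
  vert_flag x := by
    obtain ⟨x, rfl⟩ := φ.flag.surjective x
    rw [φ.vert_flag, Equiv.symm_apply_apply, Equiv.symm_apply_apply]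
  inv_flag x := by
    obtain ⟨x, rfl⟩ := φ.flag.surjective x
    rw [φ.inv_flag, Equiv.symm_apply_apply, Equiv.symm_apply_apply]
  flag_mem_out_iff x := by
    obtain ⟨x, rfl⟩ := φ.flag.surjective x
    rw [φ.flag_mem_out_iff, Equiv.symm_apply_apply]
  label_flag x hx hx' := by
    obtain ⟨x, rfl⟩ := φ.flag.surjective x
    have h : Γ.graph.inv x = x := by
      rw [φ.inv_flag] at hx
      exact φ.flag.injective hx
    rw [φ.label_flag x h hx]
    exact congrArg Γ.label (Subtype.ext (φ.flag.symm_apply_apply x))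

theorem Hom.comp_symm {Γ Δ : CyclicNecklace n} (φ : Γ ⟶ Δ) :
    φ ≫ (show Δ ⟶ Γ from Hom.symm φ) = 𝟙 Γ :=
  Hom.ext (Equiv.self_trans_symm φ.flag) (Equiv.self_trans_symm φ.vert)

theorem Hom.symm_comp {Γ Δ : CyclicNecklace n} (φ : Γ ⟶ Δ) :
    (show Δ ⟶ Γ from Hom.symm φ) ≫ φ = 𝟙 Δ :=
  Hom.ext (Equiv.symm_trans_self φ.flag) (Equiv.symm_trans_self φ.vert)

/-- An isomorphism of necklaces remains one when the legs are relabelled. -/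
def Hom.relabel {Γ Δ : CyclicNecklace n} (φ : Hom Γ Δ) (τ : Equiv.Perm (Fin n)) :
    Hom (Γ.relabel τ) (Δ.relabel τ) :=
  { φ with label_flag := fun f hf hf' => congrArg τ (φ.label_flag f hf hf') }

variable (Γ : CyclicNecklace n)

/-- The flag at a vertex where an edge starts. -/
def outFlag (v : Γ.graph.Vert) : Γ.graph.Flag := (Γ.existsUnique_out v).choose

/-- The flag at a vertex where an edge ends. -/
def inFlag (v : Γ.graph.Vert) : Γ.graph.Flag := (Γ.existsUnique_in v).choose

theorem vert_outFlag (v : Γ.graph.Vert) : Γ.graph.vert (Γ.outFlag v) = v :=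
  (Γ.existsUnique_out v).choose_spec.1.1

theorem outFlag_mem (v : Γ.graph.Vert) : Γ.outFlag v ∈ Γ.out :=
  (Γ.existsUnique_out v).choose_spec.1.2

theorem eq_outFlag {f : Γ.graph.Flag} (h : f ∈ Γ.out) : f = Γ.outFlag (Γ.graph.vert f) :=
  (Γ.existsUnique_out _).choose_spec.2 f ⟨rfl, h⟩

theorem vert_inFlag (v : Γ.graph.Vert) : Γ.graph.vert (Γ.inFlag v) = v :=
  (Γ.existsUnique_in v).choose_spec.1.1

theorem inv_inFlag_mem (v : Γ.graph.Vert) : Γ.graph.inv (Γ.inFlag v) ∈ Γ.out :=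
  (Γ.existsUnique_in v).choose_spec.1.2

theorem eq_inFlag {f : Γ.graph.Flag} (h : Γ.graph.inv f ∈ Γ.out) :
    f = Γ.inFlag (Γ.graph.vert f) :=
  (Γ.existsUnique_in _).choose_spec.2 f ⟨rfl, h⟩

theorem inv_outFlag_ne (v : Γ.graph.Vert) : Γ.graph.inv (Γ.outFlag v) ≠ Γ.outFlag v :=
  Γ.inv_ne_of_mem_out _ (Γ.outFlag_mem v)

theorem inv_inFlag_ne (v : Γ.graph.Vert) : Γ.graph.inv (Γ.inFlag v) ≠ Γ.inFlag v := fun h =>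
  Γ.inv_ne_of_mem_out _ (Γ.inv_inFlag_mem v) (congrArg Γ.graph.inv h)

theorem inFlag_notMem (v : Γ.graph.Vert) : Γ.inFlag v ∉ Γ.out :=
  (Γ.inv_mem_out_iff _ (Γ.inv_inFlag_ne v)).1 (Γ.inv_inFlag_mem v)

theorem eq_outFlag_or_eq_inFlag {f : Γ.graph.Flag} (h : Γ.graph.inv f ≠ f) :
    f = Γ.outFlag (Γ.graph.vert f) ∨ f = Γ.inFlag (Γ.graph.vert f) := by
  by_cases hf : f ∈ Γ.out
  · exact Or.inl (Γ.eq_outFlag hf)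
  · exact Or.inr (Γ.eq_inFlag ((Γ.inv_mem_out_iff f h).2 hf))

/-- The permutation of the vertices which sends the source of an edge to its target. -/
def next : Equiv.Perm Γ.graph.Vert where
  toFun v := Γ.graph.vert (Γ.graph.inv (Γ.outFlag v))
  invFun v := Γ.graph.vert (Γ.graph.inv (Γ.inFlag v))
  left_inv v := by
    have h : Γ.graph.inv (Γ.graph.inv (Γ.outFlag v)) ∈ Γ.out := by
      rw [Γ.graph.inv_inv]
      exact Γ.outFlag_mem v
    dsimp only
    rw [← Γ.eq_inFlag h, Γ.graph.inv_inv, vert_outFlag]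
  right_inv v := by
    dsimp only
    rw [← Γ.eq_outFlag (Γ.inv_inFlag_mem v), Γ.graph.inv_inv, vert_inFlag]

theorem inv_outFlag (v : Γ.graph.Vert) :
    Γ.graph.inv (Γ.outFlag v) = Γ.inFlag (Γ.next v) := by
  refine Γ.eq_inFlag ?_
  rw [Γ.graph.inv_inv]
  exact Γ.outFlag_mem v

/-- Crossing an edge is a step of `next` or of its inverse, so a connected component lies in one
cycle. -/
theorem sameCycle_next (v w : Γ.graph.Vert) : Γ.next.SameCycle v w := by
  obtain ⟨_, _⟩ := Nat.card_eq_one_iff_unique.1 Γ.isNecklace.connected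
  have h := Quot.eqvGen_exact (Subsingleton.elim (Quot.mk Γ.graph.Adj v) (Quot.mk Γ.graph.Adj w))
  induction h with
  | rel v w h =>
    obtain ⟨f, hf, rfl, rfl⟩ := h
    rcases Γ.eq_outFlag_or_eq_inFlag hf with h | h
    · have : Γ.graph.vert (Γ.graph.inv f) = Γ.next (Γ.graph.vert f) := by
        conv_lhs => rw [h]
        rfl
      rw [this]
      exact Equiv.Perm.sameCycle_apply_right.2 (Equiv.Perm.SameCycle.refl _ _)
    · have : Γ.graph.vert (Γ.graph.inv f) = Γ.next.symm (Γ.graph.vert f) := by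
        conv_lhs => rw [h]
        rfl
      rw [this]
      exact Equiv.Perm.sameCycle_symm_apply_right.2 (Equiv.Perm.SameCycle.refl _ _)
  | refl v => exact Equiv.Perm.SameCycle.refl _ _
  | symm v w _ ih => exact ih.symm
  | trans v w x _ _ ih ih' => exact ih.trans ih'

/-- Only two flags at a vertex belong to edges, while stability demands three flags. -/
theorem exists_leg (v : Γ.graph.Vert) : ∃ f : Γ.graph.Leg, Γ.graph.vert f.1 = v := by
  by_contra! h
  have hb (f : Γ.graph.flagsAt v) : ∃ b : Bool, f.1 = bif b then Γ.outFlag v else Γ.inFlag v := by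
    obtain ⟨f, rfl⟩ := f
    have hf : Γ.graph.inv f ≠ f := fun hf => h ⟨f, hf⟩ rfl
    rcases Γ.eq_outFlag_or_eq_inFlag hf with h | h
    · exact ⟨true, h⟩
    · exact ⟨false, h⟩
  choose b hb using hb
  have hinj : Function.Injective b := fun f g hfg => Subtype.ext (by rw [hb, hb, hfg])
  have h₁ := Nat.card_le_card_of_injective b hinj
  have h₂ := Γ.stable v
  simp at h₁
  lia

/-- The vertices of a necklace can be numbered such that `next` becomes the rotation. -/
theorem exists_numbering : ∃ (k : ℕ) (_ : 0 < k) (g : Fin k ≃ Γ.graph.Vert),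
    ∀ i, g (finRotate k i) = Γ.next (g i) := by
  obtain ⟨_, ⟨x⟩⟩ := Nat.card_eq_one_iff_unique.1 Γ.isNecklace.connected
  induction x using Quot.ind with | mk v =>
  -- The orbit of a base vertex is everything, so its period is the number of vertices, and the
  -- vertex numbered `i` is the `i`-th iterate.
  let k := Function.minimalPeriod Γ.next v
  have hk : 0 < k := Function.minimalPeriod_pos_of_mem_periodicPts
    (Function.Injective.mem_periodicPts Γ.next.injective v)
  have hg : Function.Bijective fun i : Fin k => Γ.next^[i] v := by
    constructor
    · intro i j hij
      exact Fin.ext (Function.iterate_injOn_Iio_minimalPeriod i.2 j.2 hij)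
    · intro w
      obtain ⟨m, rfl⟩ := (Γ.sameCycle_next v w).exists_nat_pow_eq
      refine ⟨⟨m % k, Nat.mod_lt _ hk⟩, ?_⟩
      exact (Function.iterate_mod_minimalPeriod_eq).trans (by rw [Equiv.Perm.iterate_eq_pow])
  refine ⟨k, hk, Equiv.ofBijective _ hg, fun i => ?_⟩
  obtain ⟨k', hk'⟩ := Nat.exists_eq_succ_of_ne_zero hk.ne'
  have h : ((finRotate k i : Fin k) : ℕ) = (i + 1) % k := by
    -- The formula for `finRotate` needs a successor, so the value of `k` is forgotten to allow
    -- substitution; reduction mod `k` is the wrap-around at the last vertex.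
    clear_value k
    subst hk'
    rw [finRotate_apply, Fin.val_add, Fin.val_one']
    simp
  change Γ.next^[(finRotate k i : Fin k)] v = Γ.next (Γ.next^[i] v)
  rw [h, ← Function.iterate_succ_apply' Γ.next]
  exact Function.iterate_mod_minimalPeriod_eq

end CyclicNecklace

theorem finRotate_transitive (k : ℕ) (i j : Fin k) : ∃ m : ℕ, (finRotate k ^ m) i = j := by
  obtain _ | k := k
  · exact i.elim0
  have h (m : ℕ) : (finRotate (k + 1) ^ m) i = i + Fin.ofNat (k + 1) m := by
    induction m with
    | zero => simp
    | succ m ih =>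
      rw [pow_succ', Equiv.Perm.mul_apply, ih, finRotate_apply]
      ext
      simp [Fin.val_add]
      lia
  exact ⟨(j - i : Fin (k + 1)), by rw [h]; simp⟩

namespace CyclicNecklace

variable {n : ℕ} (Γ : CyclicNecklace n)

theorem exists_permNecklace : ∃ (k : ℕ) (hk : 0 < k) (f : Surj n k),
    Nonempty (permNecklace (finRotate k) hk (finRotate_transitive k) f ⟶ Γ) := by
  obtain ⟨k, hk, g, hg⟩ := Γ.exists_numbering
  let f : Surj n k := ⟨fun s => g.symm (Γ.graph.vert (Γ.label.symm s).1), fun i => by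
    obtain ⟨x, hx⟩ := Γ.exists_leg (g i)
    exact ⟨Γ.label x, by simp [hx]⟩⟩
  let F : Fin n ⊕ Fin k × Bool → Γ.graph.Flag := fun x => match x with
    | .inl s => (Γ.label.symm s).1
    | .inr (i, true) => Γ.outFlag (g i)
    | .inr (i, false) => Γ.inFlag (g i)
  have hleg (s : Fin n) : Γ.graph.inv (Γ.label.symm s).1 = (Γ.label.symm s).1 :=
    (Γ.label.symm s).2
  have hvert (x : Fin n ⊕ Fin k × Bool) :
      Γ.graph.vert (F x) = g ((permGraph (finRotate k) f.1).vert x) := by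
    rcases x with s | ⟨i, _ | _⟩
    · exact (g.apply_symm_apply _).symm
    · exact Γ.vert_inFlag _
    · exact Γ.vert_outFlag _
  have hout (x : Fin n ⊕ Fin k × Bool) : F x ∈ Γ.out ↔ ∃ i, x = .inr (i, true) := by
    rcases x with s | ⟨i, _ | _⟩
    · exact iff_of_false (fun h => Γ.inv_ne_of_mem_out _ h (hleg s)) (by simp)
    · exact iff_of_false (Γ.inFlag_notMem _) (by simp)
    · exact iff_of_true (Γ.outFlag_mem _) ⟨i, rfl⟩
  have hinv (x : Fin n ⊕ Fin k × Bool) :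
      Γ.graph.inv (F x) = F ((permGraph (finRotate k) f.1).inv x) := by
    rcases x with s | ⟨i, _ | _⟩
    · exact hleg s
    · obtain ⟨i, rfl⟩ := (finRotate k).surjective i
      have h : (permGraph (finRotate k) f.1).inv (.inr (finRotate k i, false)) =
        .inr (i, true) := congrArg (fun i => Sum.inr (i, true)) ((finRotate k).symm_apply_apply i)
      rw [h]
      change Γ.graph.inv (Γ.inFlag _) = Γ.outFlag _
      rw [hg, ← inv_outFlag, Γ.graph.inv_inv]
    · change Γ.graph.inv (Γ.outFlag _) = Γ.inFlag _
      rw [hg, inv_outFlag]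
  -- An edge flag is determined by its vertex and its direction, a leg by its label.
  have hF : Function.Bijective F := by
    constructor
    · intro x y hxy
      have hv := g.injective ((hvert x).symm.trans ((congrArg _ hxy).trans (hvert y)))
      have hl : (∃ s, x = .inl s) ↔ ∃ s, y = .inl s := by
        have key (x : Fin n ⊕ Fin k × Bool) :
            Γ.graph.inv (F x) = F x ↔ ∃ s, x = .inl s := by
          rcases x with s | ⟨i, _ | _⟩
          · exact iff_of_true (hleg s) ⟨s, rfl⟩
          · exact iff_of_false (Γ.inv_inFlag_ne _) (by simp)
          · exact iff_of_false (Γ.inv_outFlag_ne _) (by simp)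
        rw [← key, ← key, hxy]
      have ho : (∃ i, x = .inr (i, true)) ↔ ∃ i, y = .inr (i, true) := by
        rw [← hout, ← hout, hxy]
      rcases x with s | ⟨i, b⟩
      · obtain ⟨t, rfl⟩ := hl.1 ⟨s, rfl⟩
        exact congrArg _ (Γ.label.symm.injective (Subtype.ext hxy))
      · rcases y with t | ⟨j, b'⟩
        · obtain ⟨s, hs⟩ := hl.2 ⟨t, rfl⟩
          cases hs
        · obtain rfl : i = j := hv
          cases b <;> cases b' <;> simp_all
    · intro x
      by_cases hx : Γ.graph.inv x = x
      · exact ⟨.inl (Γ.label ⟨x, hx⟩), by simp [F]⟩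
      · rcases Γ.eq_outFlag_or_eq_inFlag hx with h | h
        · exact ⟨.inr (g.symm (Γ.graph.vert x), true), by simp only [F]; simp [← h]⟩
        · exact ⟨.inr (g.symm (Γ.graph.vert x), false), by simp only [F]; simp [← h]⟩
  exact ⟨k, hk, f, ⟨{
    flag := Equiv.ofBijective F hF
    vert := g
    vert_flag := hvert
    inv_flag := hinv
    flag_mem_out_iff := hout
    label_flag := fun x hx hx' => by
      rcases x with s | ⟨i, b⟩
      · exact Γ.label.apply_symm_apply s
      · exact (permGraph_inv_ne _ f.1 i b hx).elim }⟩⟩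

end CyclicNecklace

/-! ### Cosets of `ℤ/k` as `k`-cycles -/

section CycCoset

variable {k : ℕ}

/-- The `k`-cycle `σ ∘ (i ↦ i + 1) ∘ σ⁻¹` given by the coset of `σ`. -/
def CycCoset.next (x : CycCoset k) : Equiv.Perm (Fin k) :=
  Quotient.liftOn' x (fun σ => σ * finRotate k * σ⁻¹) fun σ τ h => by
    obtain ⟨m, hm⟩ := Subgroup.mem_zpowers_iff.1 (QuotientGroup.leftRel_apply.1 h)
    obtain rfl : τ = σ * finRotate k ^ m := by rw [hm, mul_inv_cancel_left]
    group

theorem CycCoset.next_smul (σ : Equiv.Perm (Fin k)) (x : CycCoset k) :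
    CycCoset.next (σ • x) = σ * CycCoset.next x * σ⁻¹ := by
  induction x using QuotientGroup.induction_on with | H τ =>
  change σ * τ * finRotate k * (σ * τ)⁻¹ = σ * (τ * finRotate k * τ⁻¹) * σ⁻¹
  group

theorem CycCoset.next_transitive (x : CycCoset k) (i j : Fin k) :
    ∃ m : ℕ, (CycCoset.next x ^ m) i = j := by
  induction x using QuotientGroup.induction_on with | H τ =>
  obtain ⟨m, hm⟩ := finRotate_transitive k (τ⁻¹ i) (τ⁻¹ j)
  refine ⟨m, ?_⟩
  change ((τ * finRotate k * τ⁻¹) ^ m) i = j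
  rw [conj_pow, Equiv.Perm.mul_apply, Equiv.Perm.mul_apply, hm]
  exact τ.apply_symm_apply j

/-- A permutation commuting with a transitive `c` is determined by the image of one point, and some
power of `c` has the same value there. -/
theorem mem_zpowers_of_commute {c σ : Equiv.Perm (Fin k)} (hk : 0 < k)
    (hc : ∀ i j, ∃ m : ℕ, (c ^ m) i = j) (h : Commute σ c) : σ ∈ Subgroup.zpowers c := by
  obtain ⟨m, hm⟩ := hc ⟨0, hk⟩ (σ ⟨0, hk⟩)
  refine Subgroup.mem_zpowers_iff.2 ⟨m, Equiv.ext fun i => ?_⟩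
  obtain ⟨l, rfl⟩ := hc ⟨0, hk⟩ i
  rw [zpow_natCast, ← Equiv.Perm.mul_apply, ← Equiv.Perm.mul_apply, (h.pow_right l).eq, ← pow_add,
    add_comm, pow_add, Equiv.Perm.mul_apply, hm, Equiv.Perm.mul_apply]

theorem CycCoset.next_injective (hk : 0 < k) : Function.Injective (CycCoset.next (k := k)) := by
  intro x y h
  induction x using QuotientGroup.induction_on with | H σ =>
  induction y using QuotientGroup.induction_on with | H τ =>
  replace h : σ * finRotate k * σ⁻¹ = τ * finRotate k * τ⁻¹ := h
  refine QuotientGroup.eq.2 (mem_zpowers_of_commute hk (finRotate_transitive k) ?_)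
  have h' : finRotate k = σ⁻¹ * (τ * finRotate k * τ⁻¹) * σ := by rw [← h]; group
  change σ⁻¹ * τ * finRotate k = finRotate k * (σ⁻¹ * τ)
  conv_rhs => rw [h']
  group

/-- Turns compatibility of a vertex map with the edges into the relation between cosets that appears
in the coinvariants. -/
theorem CycCoset.smul_eq_of_next (hk : 0 < k) {x y : CycCoset k} {σ : Equiv.Perm (Fin k)}
    (h : ∀ i, σ (CycCoset.next x i) = CycCoset.next y (σ i)) : y = σ • x := by
  refine CycCoset.next_injective hk ?_
  rw [CycCoset.next_smul, eq_mul_inv_iff_mul_eq]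
  exact Equiv.ext fun i => (h i).symm

theorem CycCoset.apply_next (x : CycCoset k) (σ : Equiv.Perm (Fin k)) (i : Fin k) :
    σ (CycCoset.next x i) = CycCoset.next (σ • x) (σ i) := by
  rw [CycCoset.next_smul]
  simp

end CycCoset

/-! ### Summands of the plethysm as values on necklaces -/

section Comparison

variable {E : Type u} [Category.{v} E] [MonoidalCategory E] [SymmetricCategory E]

section Summand

variable (V : StableSModule E) {n k : ℕ} (c : Equiv.Perm (Fin k)) (hk : 0 < k)
  (hc : ∀ i j, ∃ m : ℕ, (c ^ m) i = j) (f : Surj n k)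

/-- The identification of a summand `⨂ i, 𝐚₀''(f⁻¹(i))` with the value `V((Γ))` on a necklace. -/
def summandIso : powSummand (aZeroSecond V) f ≅ necklaceObj V (permNecklace c hk hc f) where
  hom := tensorMap (Equiv.refl _) fun i => markedHom V (permGraphFlagsAt c f i)
  inv := tensorMap (Equiv.refl _) fun i => markedInv V (permGraphFlagsAt c f i)
  hom_inv_id := by
    refine (tensorMap_comp _ _ _ _).trans (Eq.trans ?_ (tensorMap_id _))
    exact congrArg (tensorMap (Equiv.refl _)) (funext fun i => markedHom_markedInv V _)
  inv_hom_id := by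
    refine (tensorMap_comp _ _ _ _).trans (Eq.trans ?_ (tensorMap_id _))
    exact congrArg (tensorMap (Equiv.refl _)) (funext fun i => markedInv_markedHom V _)

variable {c hk hc f} {c' : Equiv.Perm (Fin k)} {hc' : ∀ i j, ∃ m : ℕ, (c' ^ m) i = j} {f' : Surj n k}

/-- Holds factor by factor through `map_markedHom`: the isomorphism of necklaces preserves
direction, so it respects the two marked legs, one outgoing and one incoming. -/
theorem powSummandMap_summandIso (σ : Equiv.Perm (Fin k)) (τ : Equiv.Perm (Fin n))
    (hf : ∀ s, f'.1 (τ s) = σ (f.1 s)) (hσ : ∀ i, σ (c i) = c' (σ i)) :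
    powSummandMap (aZeroSecond V) σ τ hf ≫ (summandIso V c' hk hc' f').hom =
      (summandIso V c hk hc f).hom ≫
        necklaceMap V (Γ := (permNecklace c hk hc f).relabel τ) (Δ := permNecklace c' hk hc' f')
          (permNecklaceHom σ τ hf hσ) := by
  refine (tensorMap_comp _ _ _ _).trans (Eq.trans ?_ (tensorMap_comp _ _ _ _).symm)
  refine congrArg (tensorMap σ) (funext fun i => ?_)
  refine map_markedHom V _ _ _ _ (Equiv.ext fun x => ?_)
  rcases x with s | b <;> rfl

end Summand

end Comparison

/-! ### The equivalence of summand indices with necklaces -/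

/-- The data `(k, x, f)` which index the summands of `(Ass ∘ W)(n)`. -/
structure AssIndex (n : ℕ+) : Type where
  k : Set.Iic n
  coset : CycCoset (k : ℕ+)
  surj : Surj n (k : ℕ+)

/-- The necklace given by the index of a summand. -/
def AssIndex.necklace {n : ℕ+} (a : AssIndex n) : CyclicNecklace n :=
  permNecklace (CycCoset.next a.coset) a.k.1.pos (CycCoset.next_transitive a.coset) a.surj

theorem AssIndex.exists_hom {n : ℕ+} (Γ : CyclicNecklace n) :
    ∃ a : AssIndex n, Nonempty (a.necklace ⟶ Γ) := by
  obtain ⟨k, hk, f, ⟨φ⟩⟩ := Γ.exists_permNecklace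
  -- The plethysm keeps only the summands with `k ≤ n`; no necklace is lost, as each vertex carries
  -- a leg.
  have hkn : k ≤ n := by simpa using Fintype.card_le_of_surjective f.1 f.2
  have h : CycCoset.next (QuotientGroup.mk 1 : CycCoset k) = finRotate k := by
    change 1 * finRotate k * 1⁻¹ = _
    simp
  refine ⟨⟨⟨⟨k, hk⟩, hkn⟩, QuotientGroup.mk 1, f⟩, ⟨?_ ≫ φ⟩⟩
  refine permNecklaceHom (n := n) (c := CycCoset.next (QuotientGroup.mk 1 : CycCoset k))
    (hc := CycCoset.next_transitive _) 1 1 (fun _ => rfl) fun i => ?_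
  rw [h]
  rfl

/-- With the morphisms of necklaces pulled back to `AssIndex`, the functor is fully faithful by
construction. Being an equivalence it is final, so colimits over necklaces can be computed over the
indices. -/
instance {n : ℕ+} : (inducedFunctor (AssIndex.necklace (n := n))).EssSurj where
  mem_essImage Γ := by
    obtain ⟨a, ⟨φ⟩⟩ := AssIndex.exists_hom Γ
    exact ⟨a, ⟨⟨φ, CyclicNecklace.Hom.symm φ, CyclicNecklace.Hom.comp_symm φ,
      CyclicNecklace.Hom.symm_comp φ⟩⟩⟩

instance {n : ℕ+} : (inducedFunctor (AssIndex.necklace (n := n))).IsEquivalence where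

/-- The action of permutations of the vertices and of the legs on the indices of the summands. -/
def AssIndex.act {n : ℕ+} (a : AssIndex n)
    (g : Equiv.Perm (Fin (a.k : ℕ+)) × Equiv.Perm (Fin n)) : AssIndex n :=
  ⟨a.k, g.1 • a.coset, a.surj.act g⟩

/-- The isomorphism of necklaces given by permutations of the vertices and of the legs. -/
def AssIndex.actHom {n : ℕ+} (a : AssIndex n)
    (g : Equiv.Perm (Fin (a.k : ℕ+)) × Equiv.Perm (Fin n)) :
    a.necklace.relabel g.2 ⟶ (a.act g).necklace :=
  permNecklaceHom g.1 g.2 (a.surj.act_apply g) (CycCoset.apply_next a.coset g.1)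

/-- The isomorphism of necklaces given by a permutation of the vertices. -/
def AssIndex.vertHom {n : ℕ+} (a : AssIndex n) (σ : Equiv.Perm (Fin (a.k : ℕ+))) :
    a.necklace ⟶ (a.act (σ, 1)).necklace :=
  a.actHom (σ, 1)

/-! ### The plethysm as the colimit over necklaces -/

section Colimit

variable {E : Type u} [Category.{v} E] [MonoidalCategory E] [SymmetricCategory E]
  (V : StableSModule E) {n : ℕ+}

/-- The identification of the summand with an index with the value on its necklace. -/
def indexIso (a : AssIndex n) :
    powSummand (aZeroSecond V) a.surj ≅ necklaceObj V a.necklace :=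
  summandIso V (CycCoset.next a.coset) a.k.1.pos (CycCoset.next_transitive a.coset) a.surj

/-- The map of the values on necklaces given by permutations of the vertices and of the legs. -/
def actMap (a : AssIndex n) (g : Equiv.Perm (Fin (a.k : ℕ+)) × Equiv.Perm (Fin n)) :
    necklaceObj V a.necklace ⟶ necklaceObj V (a.act g).necklace :=
  necklaceMap V (Γ := a.necklace.relabel g.2) (a.actHom g)

theorem powSummandMap_indexIso (a : AssIndex n)
    (g : Equiv.Perm (Fin (a.k : ℕ+)) × Equiv.Perm (Fin n)) :
    powSummandMap (aZeroSecond V) g.1 g.2 (a.surj.act_apply g) ≫ (indexIso V (a.act g)).hom =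
      (indexIso V a).hom ≫ actMap V a g :=
  powSummandMap_summandIso V g.1 g.2 (a.surj.act_apply g) (CycCoset.apply_next a.coset g.1)

variable [HasFiniteColimits E]

/-- The map `V((Γ)) ⟶ (Ass ∘ 𝐚₀'')(n)` for the necklace given by the index of a summand. -/
def indexInj (a : AssIndex n) :
    necklaceObj V a.necklace ⟶ (plethysm (Ass E) (aZeroSecond V) n).V :=
  (indexIso V a).inv ≫ assInj (aZeroSecond V) a.k a.coset a.surj

theorem indexIso_indexInj (a : AssIndex n) :
    (indexIso V a).hom ≫ indexInj V a = assInj (aZeroSecond V) a.k a.coset a.surj :=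
  Iso.hom_inv_id_assoc _ _

theorem actMap_indexInj (a : AssIndex n) (g : Equiv.Perm (Fin (a.k : ℕ+)) × Equiv.Perm (Fin n)) :
    (indexIso V a).hom ≫ actMap V a g ≫ indexInj V (a.act g) =
      powSummandMap (aZeroSecond V) g.1 g.2 (a.surj.act_apply g) ≫
        assInj (aZeroSecond V) a.k (g.1 • a.coset) (a.surj.act g) :=
  (Category.assoc _ _ _).symm.trans ((congrArg (· ≫ indexInj V (a.act g))
    (powSummandMap_indexIso V a g).symm).trans ((Category.assoc _ _ _).trans
      (congrArg (_ ≫ ·) (indexIso_indexInj V (a.act g)))))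

theorem vertHom_indexInj (a : AssIndex n) (σ : Equiv.Perm (Fin (a.k : ℕ+))) :
    necklaceMap V (a.vertHom σ) ≫ indexInj V (a.act (σ, 1)) = indexInj V a :=
  (cancel_epi (indexIso V a).hom).1 ((actMap_indexInj V a (σ, 1)).trans
    ((powSummandMap_assInj (aZeroSecond V) a.k σ a.coset a.surj).trans
      (indexIso_indexInj V a).symm))

theorem indexInj_ρ (a : AssIndex n) (τ : Equiv.Perm (Fin n)) :
    indexInj V a ≫ (plethysm (Ass E) (aZeroSecond V) n).ρ τ =
      actMap V a (1, τ) ≫ indexInj V (a.act (1, τ)) := by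
  refine (cancel_epi (indexIso V a).hom).1 (Eq.trans ?_ (actMap_indexInj V a (1, τ)).symm)
  refine Eq.trans ?_ (assInj_ρ (aZeroSecond V) a.k τ a.coset a.surj)
  exact (Category.assoc _ _ _).symm.trans (congrArg (· ≫ _) (indexIso_indexInj V a))

/-- Every isomorphism between standard necklaces is a `vertHom`, so compatibility with all of them
is just the coinvariance relation. -/
theorem necklaceMap_indexInj {a b : AssIndex n} (φ : a.necklace ⟶ b.necklace) :
    necklaceMap V φ ≫ indexInj V b = indexInj V a := by
  obtain ⟨k, x, f⟩ := a
  obtain ⟨l, y, g⟩ := b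
  -- An isomorphism preserves the number of vertices, so distinct summands of the direct sum are not
  -- related.
  obtain rfl : k = l := by
    refine Subtype.ext (PNat.eq ?_)
    simpa using Fintype.card_congr (show Fin (k : ℕ+) ≃ Fin (l : ℕ+) from φ.vert)
  obtain ⟨σ, hf, hσ, rfl⟩ := exists_eq_permNecklaceHom φ
  obtain rfl := CycCoset.smul_eq_of_next k.1.pos hσ
  obtain rfl : g = f.act (σ, 1) := Subtype.ext (funext hf)
  exact vertHom_indexInj V ⟨k, x, f⟩ σ

/-- The cocone over the necklaces given by the indices of the summands. -/
def indexCocone (n : ℕ+) :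
    Cocone (inducedFunctor (AssIndex.necklace (n := n)) ⋙ necklaceFunctor V n) where
  pt := (plethysm (Ass E) (aZeroSecond V) n).V
  ι :=
    { app a := indexInj V a
      naturality _ _ φ := (necklaceMap_indexInj V φ.hom).trans (Category.comp_id _).symm }

/-- The cocone over all necklaces. -/
def necklaceCocone (n : ℕ+) : Cocone (necklaceFunctor V n) :=
  (Functor.Final.extendCocone (F := inducedFunctor (AssIndex.necklace (n := n)))).obj
    (indexCocone V n)

/-- The extended cocone is built from a chosen morphism to a standard necklace; on a standard
necklace the identity may be used instead. -/
theorem necklaceCocone_ι_app (a : AssIndex n) :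
    (necklaceCocone V n).ι.app a.necklace = indexInj V a :=
  (Functor.Final.extendCocone_obj_ι_app' (F := inducedFunctor (AssIndex.necklace (n := n)))
    (indexCocone V n) (Y := a) (𝟙 _)).trans
      ((congrArg (· ≫ _) ((necklaceFunctor V n).map_id _)).trans (Category.id_comp _))

theorem necklaceCocone_relabel (σ : Equiv.Perm (Fin n)) (Γ : CyclicNecklace n) :
    (necklaceCocone V n).ι.app Γ ≫ (plethysm (Ass E) (aZeroSecond V) n).ρ σ =
      (necklaceCocone V n).ι.app (Γ.relabel σ) := by
  obtain ⟨a, ⟨φ⟩⟩ := AssIndex.exists_hom Γ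
  have : IsIso φ := ⟨CyclicNecklace.Hom.symm φ, CyclicNecklace.Hom.comp_symm φ,
      CyclicNecklace.Hom.symm_comp φ⟩
  have h₁ := (necklaceCocone V n).w φ
  have h₂ := (necklaceCocone V n).w (j' := a.necklace.relabel σ) (j := Γ.relabel σ)
    (CyclicNecklace.Hom.relabel φ σ)
  have h₃ := (necklaceCocone V n).w (a.actHom (1, σ))
  rw [necklaceCocone_ι_app] at h₁ h₃
  -- Precomposing with the isomorphism `φ` reduces the claim to a standard necklace, where
  -- `indexInj_ρ` applies.
  refine (cancel_epi ((necklaceFunctor V n).map φ)).1 ?_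
  refine (Category.assoc _ _ _).symm.trans ((congrArg (· ≫ _) h₁).trans ?_)
  exact (indexInj_ρ V a σ).trans (h₃.trans h₂.symm)

variable [Preadditive E] [MonoidalPreadditive E]

/-- Naturality of the cocone along the morphisms `vertHom` is precisely the hypothesis of
`exists_ass_desc`. -/
theorem exists_indexCocone_desc
    (s : Cocone (inducedFunctor (AssIndex.necklace (n := n)) ⋙ necklaceFunctor V n)) :
    ∃ p : (plethysm (Ass E) (aZeroSecond V) n).V ⟶ s.pt,
      ∀ a : AssIndex n, indexInj V a ≫ p = s.ι.app a := by
  obtain ⟨p, hp⟩ := exists_ass_desc (aZeroSecond V)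
    (fun k x f => (indexIso V ⟨k, x, f⟩).hom ≫ s.ι.app (⟨k, x, f⟩ : AssIndex n)) fun k σ x f => by
      refine (Category.assoc _ _ _).symm.trans ?_
      refine (congrArg (· ≫ s.ι.app (AssIndex.act ⟨k, x, f⟩ (σ, 1)))
        (powSummandMap_indexIso V ⟨k, x, f⟩ (σ, 1))).trans ?_
      refine (Category.assoc _ _ _).trans (congrArg ((indexIso V ⟨k, x, f⟩).hom ≫ ·) ?_)
      exact s.w (j' := (⟨k, x, f⟩ : AssIndex n)) (j := AssIndex.act ⟨k, x, f⟩ (σ, 1))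
        (InducedCategory.homMk (AssIndex.vertHom ⟨k, x, f⟩ σ))
  refine ⟨p, fun a => ?_⟩
  refine (Category.assoc _ _ _).trans ((congrArg (_ ≫ ·) (hp a.k a.coset a.surj)).trans ?_)
  exact Iso.inv_hom_id_assoc (indexIso V a) _

theorem index_hom_ext {Z : E} {p q : (plethysm (Ass E) (aZeroSecond V) n).V ⟶ Z}
    (h : ∀ a : AssIndex n, indexInj V a ≫ p = indexInj V a ≫ q) : p = q := by
  refine assInj_hom_ext _ fun k x f => ?_
  have h₁ := indexIso_indexInj V ⟨k, x, f⟩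
  refine (congrArg (· ≫ p) h₁.symm).trans (Eq.trans ?_ (congrArg (· ≫ q) h₁))
  rw [Category.assoc, Category.assoc, h]

/-- `(Ass ∘ 𝐚₀'')(n)` is the colimit over the necklaces given by the indices of the summands. -/
def indexCoconeIsColimit (n : ℕ+) : IsColimit (indexCocone V n) where
  desc s := (exists_indexCocone_desc V s).choose
  fac s a := (exists_indexCocone_desc V s).choose_spec a
  uniq s _ h := index_hom_ext V fun a =>
    (h a).trans ((exists_indexCocone_desc V s).choose_spec a).symm

end Colimit

end SModules

end

open SModules

theorem mainTheorem7 {𝕜 : Type*} [Field 𝕜] [CharZero 𝕜] {E : Type*} [Category* E]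
    [MonoidalCategory E] [SymmetricCategory E] [Preadditive E] [Linear 𝕜 E]
    [MonoidalPreadditive E] [MonoidalLinear 𝕜 E] [HasFiniteColimits E] (V : StableSModule E) :
    Nonempty (NecklaceModule V (plethysm (Ass E) (aZeroSecond V))) :=
  ⟨{ ι := fun n => (necklaceCocone V n).ι
     isColimit := fun n =>
      (Functor.Final.isColimitExtendCoconeEquiv _ _).symm (indexCoconeIsColimit V n)
     ι_relabel := fun _ σ Γ => necklaceCocone_relabel V σ Γ }⟩
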